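/- Let $F$ be a field and let $z_1,\dots,z_m$ be non-zero $F$-linear combinations of the coordinates $x_1,\dots,x_n$. Put $R=F[x_1,\dots,x_n][z_1^{-1},\dots,z_m^{-1}]$ and let $I$ be the kernel of the ring homomorphism $$h:F[t_1,\dots,t_m]\to R,\qquad t_i\mapsto z_i^{-1}.$$ Put $T=z_1^{-1}\cdots z_m^{-1}\bigl(F[x_1,\dots,x_n]\otimes\Lambda_F[dx_1,\dots,dx_n]\bigr)$ and $\Xi=F[t_1,\dots,t_m]\otimes\Lambda_F[u_1,\dots,u_m]$, and let $K$ be the kernel of the ring homomorphism $$\psi:\Xi\to T,\qquad t_i\mapsto z_i^{-1},\quad u_i\mapsto z_i^{-1}dz_i .$$ A relation is a non-zero vector $L=(a_1,\dots,a_m)\in F^m$ with $a_1z_1+\dots+a_mz_m=0$; its support is $|L|=\{i\mid a_i\neq0\}$. A relation $L$ is minimal if there are no relations $L_1,L_2$ with $L_1+L_2=L$ and $|L_1|\subsetneq|L|$, $|L_2|\subsetneq|L|$. For a relation $L$ put $$P_L=\sum_{i\in|L|}a_i\prod_{k\in|L|\smallsetminus\{i\}}t_k\in F[t_1,\dots,t_m].$$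 In $t_1^{-1}\cdots t_m^{-1}\,\Xi$ write $dz_i=t_i^{-1}u_i$ and $dL=\sum_{i\in|L|}a_i\,dz_i$, and for $S=\{j_1<\dots<j_l\}\subseteq|L|$ put $$P_{L,S}=P_L\,dz_{j_1}\cdots dz_{j_l}-\sum_{s=1}^{l}\Bigl(\prod_{k\in|L|\smallsetminus\{j_s\}}t_k\Bigr)\,dz_{j_1}\cdots dz_{j_{s-1}}\,dL\,dz_{j_{s+1}}\cdots dz_{j_l},$$ which is an element of the subring $\Xi$. Then, as an ideal of $F[t_1,\dots,t_m]$ and as a two-sided ideal of $\Xi$ respectively, $$I=(P_L\mid L\text{ a minimal relation}),\qquad K=(P_{L,S}\mid L\text{ a minimal relation},\ S\subseteq|L|).$$ -/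

import Mathlib

open scoped TensorProduct

namespace ReciprocalPlane

noncomputable section

/-! ### Ordered products -/

/-- The product of the `f j`, `j ∈ S`, in increasing order of the indices. -/
def oprod {A : Type*} [Monoid A] {m : ℕ} (S : Finset (Fin m)) (f : Fin m → A) : A :=
  ((S.sort (· ≤ ·)).map f).prod

/-! ### The linear forms and the even ring homomorphism -/

/-- The linear form `z_i = ∑_j c i j x_j` in `F[x_1, …, x_n]`. -/
def linForm {F : Type*} [Field F] {n m : ℕ} (c : Fin m → Fin n → F) (i : Fin m) :
    MvPolynomial (Fin n) F :=
  ∑ j, MvPolynomial.C (c i j) * MvPolynomial.X j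

/-- The multiplicative set generated by `z_1, …, z_m`. -/
def zMonoid {F : Type*} [Field F] {n m : ℕ} (c : Fin m → Fin n → F) :
    Submonoid (MvPolynomial (Fin n) F) :=
  Submonoid.closure (Set.range (linForm c))

/-- The ring `R = F[x_1, …, x_n][z_1⁻¹, …, z_m⁻¹]`. -/
abbrev R {F : Type*} [Field F] {n m : ℕ} (c : Fin m → Fin n → F) : Type _ :=
  Localization (zMonoid c)

/-- The element `z_i⁻¹` of `R`. -/
def zInv {F : Type*} [Field F] {n m : ℕ} (c : Fin m → Fin n → F) (i : Fin m) : R c :=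
  Localization.mk 1 ⟨linForm c i, Submonoid.subset_closure ⟨i, rfl⟩⟩

/-- The homomorphism `h : F[t_1, …, t_m] → R`, `t_i ↦ z_i⁻¹`. -/
def h {F : Type*} [Field F] {n m : ℕ} (c : Fin m → Fin n → F) :
    MvPolynomial (Fin m) F →ₐ[F] R c :=
  MvPolynomial.aeval (zInv c)

/-! ### The graded-commutative rings and the homomorphism between them -/

/-- The ring `T = z_1⁻¹ ⋯ z_m⁻¹ (F[x_1, …, x_n] ⊗ Λ[dx_1, …, dx_n])`.  The `z_i` are central and
lie in the left tensor factor, so they are inverted there; `dx_j` is the image of the `j`-th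
standard basis vector of `Fin n → F`. -/
abbrev T {F : Type*} [Field F] {n m : ℕ} (c : Fin m → Fin n → F) : Type _ :=
  R c ⊗[F] ExteriorAlgebra F (Fin n → F)

/-- The ring `Ξ = F[t_1, …, t_m] ⊗ Λ[u_1, …, u_m]`. -/
abbrev Xi (F : Type*) [Field F] (m : ℕ) : Type _ :=
  MvPolynomial (Fin m) F ⊗[F] ExteriorAlgebra F (Fin m → F)

/-- The generator `u_i` of `Ξ`. -/
def u (F : Type*) [Field F] {m : ℕ} (i : Fin m) : Xi F m :=
  1 ⊗ₜ ExteriorAlgebra.ι F (Pi.single i 1)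

/-- The element `z_i⁻¹ dz_i` of `T`, where `dz_i = ∑_j c i j dx_j`. -/
def zInvDz {F : Type*} [Field F] {n m : ℕ} (c : Fin m → Fin n → F) (i : Fin m) : T c :=
  zInv c i ⊗ₜ ExteriorAlgebra.ι F (c i)

theorem sq_sum_eq_zero {B ι : Type*} [Ring B] (s : Finset ι) (w : ι → B)
    (h0 : ∀ i, w i * w i = 0) (h1 : ∀ i j, w i * w j + w j * w i = 0) :
    (∑ i ∈ s, w i) * (∑ i ∈ s, w i) = 0 := by
  classical
  induction s using Finset.induction_on with
  | empty => simp
  | insert a s ha ih =>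
    rw [Finset.sum_insert ha]
    have hc : w a * (∑ i ∈ s, w i) + (∑ i ∈ s, w i) * w a = 0 := by
      rw [Finset.mul_sum, Finset.sum_mul, ← Finset.sum_add_distrib]
      exact Finset.sum_eq_zero fun i _ => h1 a i
    calc _ = w a * w a + (w a * (∑ i ∈ s, w i) + (∑ i ∈ s, w i) * w a)
          + (∑ i ∈ s, w i) * (∑ i ∈ s, w i) := by noncomm_ring
      _ = 0 := by rw [h0, hc, ih]; simp

/-- The linear map `Λ¹[u_1, …, u_m] → T`, `u_i ↦ z_i⁻¹ dz_i`. -/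
def psiOne {F : Type*} [Field F] {n m : ℕ} (c : Fin m → Fin n → F) :
    (Fin m → F) →ₗ[F] T c :=
  Fintype.linearCombination F (zInvDz c)

theorem psiOne_sq {F : Type*} [Field F] {n m : ℕ} (c : Fin m → Fin n → F) (v : Fin m → F) :
    psiOne c v * psiOne c v = 0 := by
  have hq : ∀ i j, zInvDz c i * zInvDz c j + zInvDz c j * zInvDz c i = 0 := by
    intro i j
    rw [zInvDz, zInvDz, Algebra.TensorProduct.tmul_mul_tmul, Algebra.TensorProduct.tmul_mul_tmul,
      mul_comm (zInv c j), ← TensorProduct.tmul_add, ExteriorAlgebra.ι_add_mul_swap,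
      TensorProduct.tmul_zero]
  rw [psiOne, Fintype.linearCombination_apply]
  refine sq_sum_eq_zero (B := T c) Finset.univ (fun i => v i • zInvDz c i) ?_ ?_
  · intro i
    rw [smul_mul_smul_comm, zInvDz, Algebra.TensorProduct.tmul_mul_tmul,
      ExteriorAlgebra.ι_sq_zero, TensorProduct.tmul_zero, smul_zero]
  · intro i j
    rw [smul_mul_smul_comm, smul_mul_smul_comm, mul_comm (v j), ← smul_add, hq, smul_zero]

/-- The homomorphism `ψ : Ξ → T`, `t_i ↦ z_i⁻¹`, `u_i ↦ z_i⁻¹ dz_i`. -/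
def psi {F : Type*} [Field F] {n m : ℕ} (c : Fin m → Fin n → F) : Xi F m →ₐ[F] T c :=
  Algebra.TensorProduct.lift (Algebra.TensorProduct.includeLeft.comp (h c))
    (ExteriorAlgebra.lift F ⟨psiOne c, psiOne_sq c⟩)
    (fun p q => by
      change Commute ((h c p) ⊗ₜ[F] (1 : ExteriorAlgebra F (Fin n → F))) _
      generalize ExteriorAlgebra.lift F ⟨psiOne c, psiOne_sq c⟩ q = y
      induction y using TensorProduct.induction_on with
      | zero => exact Commute.zero_right _
      | tmul a b =>
        simp [Commute, SemiconjBy, Algebra.TensorProduct.tmul_mul_tmul, mul_comm]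
      | add a b ha hb => exact ha.add_right hb)

theorem psi_t {F : Type*} [Field F] {n m : ℕ} (c : Fin m → Fin n → F) (i : Fin m) :
    psi c (MvPolynomial.X i ⊗ₜ 1) = zInv c i ⊗ₜ 1 := by
  simp [psi, h]

theorem psi_u {F : Type*} [Field F] {n m : ℕ} (c : Fin m → Fin n → F) (i : Fin m) :
    psi c (u F i) = zInvDz c i := by
  simp [psi, u, psiOne, Fintype.linearCombination_apply_single, ← Algebra.TensorProduct.one_def]

/-! ### Relations -/

open Classical in
/-- The index set `|L|` of `L = ∑ a_i z_i`: the indices with nonzero coefficient. -/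
def supp {F : Type*} [Field F] {m : ℕ} (a : Fin m → F) : Finset (Fin m) :=
  Finset.univ.filter fun i => a i ≠ 0

/-- `a` is the coefficient vector of a nonzero linear relation `∑ a_i z_i = 0`. -/
def IsRelation {F : Type*} [Field F] {n m : ℕ} (c : Fin m → Fin n → F) (a : Fin m → F) : Prop :=
  a ≠ 0 ∧ ∑ i, MvPolynomial.C (a i) * linForm c i = 0

/-- A relation `L` is minimal if it is not a sum of two relations `L₁`, `L₂` with
`|L₁|, |L₂| ⊊ |L|`. -/
def IsMinimalRelation {F : Type*} [Field F] {n m : ℕ} (c : Fin m → Fin n → F)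
    (a : Fin m → F) : Prop :=
  IsRelation c a ∧ ¬ ∃ a₁ a₂ : Fin m → F, IsRelation c a₁ ∧ IsRelation c a₂ ∧
    a₁ + a₂ = a ∧ supp a₁ ⊂ supp a ∧ supp a₂ ⊂ supp a

/-- `P_L = ∑_{i ∈ |L|} a_i ∏_{j ∈ |L| ∖ {i}} t_j`. -/
def relPoly {F : Type*} [Field F] {m : ℕ} (a : Fin m → F) : MvPolynomial (Fin m) F :=
  ∑ i ∈ supp a, MvPolynomial.C (a i) * ∏ j ∈ (supp a).erase i, MvPolynomial.X j

/-- The element `P_{L,S}` of `Ξ`, for `S = {j_1 < ⋯ < j_l} ⊆ |L|`.  It is obtained from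
`P_L dz_{j_1} ⋯ dz_{j_l} - ∑_s t_{|L| ∖ {j_s}} dz_{j_1} ⋯ dL ⋯ dz_{j_l}` (`dL` in place of
`dz_{j_s}`) by expanding `dL = ∑ a_i dz_i`, cancelling, and writing `t_i dz_i = u_i`; see
`toLoc_relPolySuper`, where this identity is proved in `t_1⁻¹ ⋯ t_m⁻¹ Ξ`. -/
def relPolySuper {F : Type*} [Field F] {m : ℕ} (a : Fin m → F) (S : Finset (Fin m)) : Xi F m :=
  ∑ i ∈ supp a \ S,
    (MvPolynomial.C (a i) * ∏ k ∈ supp a \ insert i S, MvPolynomial.X k) ⊗ₜ[F] 1 *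
      (oprod S (u F) - ∑ j ∈ S, oprod S (Function.update (u F) j (u F i)))

/-! ### `P_{L,S}` inside the localization of `Ξ` at the `t_i` -/

/-- The polynomial ring `F[t_1, …, t_m]` with all `t_i` inverted. -/
abbrev TLoc (F : Type*) [Field F] (m : ℕ) : Type _ :=
  Localization (Submonoid.closure (Set.range (MvPolynomial.X : Fin m → MvPolynomial (Fin m) F)))

/-- The ring `t_1⁻¹ ⋯ t_m⁻¹ Ξ`. -/
abbrev XiLoc (F : Type*) [Field F] (m : ℕ) : Type _ :=
  TLoc F m ⊗[F] ExteriorAlgebra F (Fin m → F)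

/-- The canonical homomorphism `Ξ → t_1⁻¹ ⋯ t_m⁻¹ Ξ`. -/
def toLoc (F : Type*) [Field F] (m : ℕ) : Xi F m →ₐ[F] XiLoc F m :=
  Algebra.TensorProduct.map (IsScalarTower.toAlgHom F (MvPolynomial (Fin m) F) (TLoc F m))
    (AlgHom.id F _)

/-- The element `dz_i = t_i⁻¹ u_i` of `t_1⁻¹ ⋯ t_m⁻¹ Ξ`. -/
def dz (F : Type*) [Field F] {m : ℕ} (i : Fin m) : XiLoc F m :=
  (Localization.mk 1 ⟨MvPolynomial.X i, Submonoid.subset_closure ⟨i, rfl⟩⟩ : TLoc F m) ⊗ₜ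
    ExteriorAlgebra.ι F (Pi.single i 1)

/-- The element `dL = ∑ a_i dz_i` of `t_1⁻¹ ⋯ t_m⁻¹ Ξ`. -/
def dRel {F : Type*} [Field F] {m : ℕ} (a : Fin m → F) : XiLoc F m :=
  ∑ i ∈ supp a, a i • dz F i

theorem toLoc_injective (F : Type*) [Field F] (m : ℕ) : Function.Injective (toLoc F m) := by
  have hinj : Function.Injective
      (IsScalarTower.toAlgHom F (MvPolynomial (Fin m) F) (TLoc F m)).toLinearMap := by
    apply IsLocalization.injective (TLoc F m)
      (M := Submonoid.closure (Set.range (MvPolynomial.X : Fin m → MvPolynomial (Fin m) F)))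
    rw [Submonoid.closure_le]
    rintro _ ⟨i, rfl⟩
    exact mem_nonZeroDivisors_of_ne_zero (MvPolynomial.X_ne_zero i)
  exact Module.Flat.rTensor_preserves_injective_linearMap _ hinj

theorem mul_list_prod_eq_zero {B ι : Type*} [Ring B] (v : ι → B)
    (h0 : ∀ i, v i * v i = 0) (h1 : ∀ i j, v i * v j + v j * v i = 0) (x : ι) :
    ∀ l : List ι, x ∈ l → v x * (l.map v).prod = 0 := by
  classical
  intro l
  induction l with
  | nil => intro hx; simp at hx
  | cons y l ih =>
    intro hx
    rw [List.map_cons, List.prod_cons, ← mul_assoc]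
    by_cases hxy : x = y
    · rw [hxy, h0, zero_mul]
    · have hx' : x ∈ l := by simpa [hxy] using hx
      rw [eq_neg_of_add_eq_zero_left (h1 x y), neg_mul, mul_assoc, ih hx', mul_zero, neg_zero]

theorem list_prod_eq_zero {B ι : Type*} [Ring B] (v : ι → B)
    (h0 : ∀ i, v i * v i = 0) (h1 : ∀ i j, v i * v j + v j * v i = 0) :
    ∀ l : List ι, ¬ l.Nodup → (l.map v).prod = 0 := by
  intro l
  induction l with
  | nil => intro hl; simp at hl
  | cons y l ih =>
    intro hl
    rw [List.map_cons, List.prod_cons]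
    by_cases hy : y ∈ l
    · exact mul_list_prod_eq_zero v h0 h1 y l hy
    · rw [ih (fun hn => hl (List.nodup_cons.2 ⟨hy, hn⟩)), mul_zero]

theorem oprod_update_eq_zero {B : Type*} [Ring B] {m : ℕ} (v : Fin m → B)
    (h0 : ∀ i, v i * v i = 0) (h1 : ∀ i j, v i * v j + v j * v i = 0)
    (S : Finset (Fin m)) (i j : Fin m) (hi : i ∈ S) (hj : j ∈ S) (hij : i ≠ j) :
    oprod S (Function.update v j (v i)) = 0 := by
  have e : Function.update v j (v i) = v ∘ Function.update id j i := by
    rw [Function.comp_update]; rfl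
  rw [oprod, e, ← List.map_map]
  apply list_prod_eq_zero v h0 h1
  intro hn
  have := List.inj_on_of_nodup_map hn ((Finset.mem_sort _).2 hi) ((Finset.mem_sort _).2 hj)
    (by simp [hij])
  exact hij this

theorem oprod_update_split {B : Type*} [Ring B] {m : ℕ} (v : Fin m → B)
    (S : Finset (Fin m)) (j : Fin m) (hj : j ∈ S) :
    ∃ p q : B, ∀ w, oprod S (Function.update v j w) = p * w * q := by
  obtain ⟨l₁, l₂, hl⟩ := List.append_of_mem ((Finset.mem_sort (· ≤ ·)).2 hj)
  have hn : (S.sort (· ≤ ·)).Nodup := Finset.sort_nodup _ _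
  rw [hl, List.nodup_append] at hn
  refine ⟨(l₁.map v).prod, (l₂.map v).prod, fun w => ?_⟩
  have e1 : l₁.map (Function.update v j w) = l₁.map v :=
    List.map_congr_left fun x hx => Function.update_of_ne (hn.2.2 x hx j (by simp)) _ _
  have e2 : l₂.map (Function.update v j w) = l₂.map v :=
    List.map_congr_left fun x hx => Function.update_of_ne
      (fun h => (List.nodup_cons.1 hn.2.1).1 (by rwa [h] at hx)) _ _
  rw [oprod, hl, List.map_append, List.map_cons, List.prod_append, List.prod_cons, e1, e2,
    Function.update_self, mul_assoc]

theorem oprod_update_sum {F B : Type*} [Field F] [Ring B] [Algebra F B] {m : ℕ} (v : Fin m → B)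
    (h0 : ∀ i, v i * v i = 0) (h1 : ∀ i j, v i * v j + v j * v i = 0) (a : Fin m → F)
    (K S : Finset (Fin m)) (hS : S ⊆ K) (j : Fin m) (hj : j ∈ S) :
    oprod S (Function.update v j (∑ i ∈ K, a i • v i)) = a j • oprod S v +
      ∑ i ∈ K \ S, a i • oprod S (Function.update v j (v i)) := by
  have e : oprod S (Function.update v j (∑ i ∈ K, a i • v i))
      = ∑ i ∈ K, a i • oprod S (Function.update v j (v i)) := by
    obtain ⟨p, q, hpq⟩ := oprod_update_split v S j hj
    simp only [hpq, Finset.mul_sum, Finset.sum_mul, mul_smul_comm, smul_mul_assoc]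
  rw [e, ← Finset.sum_sdiff hS, add_comm]
  congr 1
  rw [Finset.sum_eq_single_of_mem j hj, Function.update_eq_self]
  intro i hi hij
  rw [oprod_update_eq_zero v h0 h1 S i j hi hj hij, smul_zero]

theorem sum_rearrange {F B : Type*} [Field F] [Ring B] [Algebra F B] {m : ℕ} (a : Fin m → F)
    (K S : Finset (Fin m)) (hS : S ⊆ K) (θ : Fin m → B) (w : B) (W : Fin m → Fin m → B) :
    ∑ i ∈ K \ S, a i • (θ i * w - ∑ j ∈ S, θ j * W j i) =
      (∑ i ∈ K, a i • θ i) * w -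
        ∑ j ∈ S, θ j * (a j • w + ∑ i ∈ K \ S, a i • W j i) := by
  simp only [smul_sub, Finset.sum_sub_distrib, mul_add, Finset.sum_add_distrib, Finset.mul_sum,
    Finset.smul_sum, Finset.sum_mul, mul_smul_comm, smul_mul_assoc]
  rw [← Finset.sum_sdiff hS, Finset.sum_comm (s := S)]
  abel

theorem prod_sdiff_mul_prod {A : Type*} [CommMonoid A] {m : ℕ} (x : Fin m → A)
    (K S : Finset (Fin m)) (hS : S ⊆ K) (i : Fin m) (hi : i ∈ K \ S) :
    (∏ k ∈ K \ insert i S, x k) * ∏ k ∈ S, x k = ∏ k ∈ K.erase i, x k := by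
  have hd : Disjoint (K \ insert i S) S :=
    Finset.disjoint_left.2 fun k hk hk' => by simp [hk'] at hk
  rw [← Finset.prod_union hd]
  congr 1
  ext k
  have := @hS k
  grind

theorem prod_sdiff_mul_prod_update {A : Type*} [CommMonoid A] {m : ℕ} (x : Fin m → A)
    (K S : Finset (Fin m)) (hS : S ⊆ K) (i : Fin m) (hi : i ∈ K \ S) (j : Fin m) (hj : j ∈ S) :
    (∏ k ∈ K \ insert i S, x k) * ∏ k ∈ S, x (Function.update id j i k) =
      ∏ k ∈ K.erase j, x k := by
  have e : ∏ k ∈ S, x (Function.update id j i k) = x i * ∏ k ∈ S.erase j, x k := by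
    rw [← Finset.mul_prod_erase S _ hj, Function.update_self]
    congr 1
    refine Finset.prod_congr rfl fun k hk => ?_
    rw [Function.update_of_ne (Finset.ne_of_mem_erase hk), id]
  have hij : i ∈ K.erase j := by grind
  rw [e, ← Finset.mul_prod_erase (K.erase j) _ hij, mul_left_comm]
  congr 1
  have hd : Disjoint (K \ insert i S) (S.erase j) :=
    Finset.disjoint_left.2 fun k hk hk' => by grind
  rw [← Finset.prod_union hd]
  congr 1
  ext k
  have := @hS k
  grind

theorem oprod_tmul {F A E : Type*} [Field F] [CommRing A] [Algebra F A] [Ring E] [Algebra F E]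
    {m : ℕ} (S : Finset (Fin m)) (r : Fin m → A) (e : Fin m → E) :
    oprod S (fun i => r i ⊗ₜ[F] e i) = (∏ i ∈ S, r i) ⊗ₜ[F] oprod S e := by
  have h : ∀ l : List (Fin m), (l.map (fun i => r i ⊗ₜ[F] e i)).prod
      = (l.map r).prod ⊗ₜ[F] (l.map e).prod := by
    intro l
    induction l with
    | nil => rfl
    | cons x l ih => simp [ih, Algebra.TensorProduct.tmul_mul_tmul]
  rw [oprod, h, oprod]
  congr 1
  conv_rhs => rw [← Finset.sort_toFinset S (· ≤ ·)]
  rw [List.prod_toFinset _ (Finset.sort_nodup _ _)]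

/-- The image of `t_i` in the localized polynomial ring times `t_i⁻¹` is `1`. -/
theorem algebraMap_X_mul_inv (F : Type*) [Field F] {m : ℕ} (i : Fin m) :
    algebraMap (MvPolynomial (Fin m) F) (TLoc F m) (MvPolynomial.X i) *
      (Localization.mk 1 ⟨MvPolynomial.X i, Submonoid.subset_closure ⟨i, rfl⟩⟩ : TLoc F m) = 1 := by
  rw [← Localization.mk_one_eq_algebraMap, Localization.mk_mul, ← Localization.mk_one,
    Localization.mk_eq_mk_iff, Localization.r_iff_exists]
  exact ⟨1, by simp⟩

theorem toLoc_oprod (F : Type*) [Field F] {m : ℕ} (S : Finset (Fin m)) (g : Fin m → Fin m) :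
    toLoc F m (oprod S (u F ∘ g)) =
      toLoc F m ((∏ k ∈ S, MvPolynomial.X (g k)) ⊗ₜ 1) * oprod S (dz F ∘ g) := by
  have e1 : oprod S (u F ∘ g) = (∏ k ∈ S, (1 : MvPolynomial (Fin m) F)) ⊗ₜ[F]
      oprod S (fun k => ExteriorAlgebra.ι F (Pi.single (g k) 1 : Fin m → F)) :=
    oprod_tmul S (fun _ => 1) _
  have e2 : oprod S (dz F ∘ g) = (∏ k ∈ S, (Localization.mk 1 ⟨MvPolynomial.X (g k),
      Submonoid.subset_closure ⟨g k, rfl⟩⟩ : TLoc F m)) ⊗ₜ[F]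
      oprod S (fun k => ExteriorAlgebra.ι F (Pi.single (g k) 1 : Fin m → F)) :=
    oprod_tmul S _ _
  rw [e1, e2]
  simp only [toLoc, Algebra.TensorProduct.map_tmul, map_prod, IsScalarTower.coe_toAlgHom',
    AlgHom.coe_id, id, Algebra.TensorProduct.tmul_mul_tmul, one_mul, ← Finset.prod_mul_distrib,
    algebraMap_X_mul_inv, map_one, Finset.prod_const_one]

/-- The image of `P_{L,S}` in `t_1⁻¹ ⋯ t_m⁻¹ Ξ` is
`P_L dz_{j_1} ⋯ dz_{j_l} - ∑_s t_{|L| ∖ {j_s}} dz_{j_1} ⋯ dL ⋯ dz_{j_l}`, where `dL` stands in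
the place of `dz_{j_s}`. -/
theorem toLoc_relPolySuper {F : Type*} [Field F] {m : ℕ} (a : Fin m → F) (S : Finset (Fin m))
    (hS : S ⊆ supp a) :
    toLoc F m (relPolySuper a S) =
      toLoc F m (relPoly a ⊗ₜ 1) * oprod S (dz F) -
        ∑ j ∈ S, toLoc F m ((∏ k ∈ (supp a).erase j, MvPolynomial.X k) ⊗ₜ 1) *
          oprod S (Function.update (dz F) j (dRel a)) := by
  have q1 : ∀ i j : Fin m, dz F i * dz F j + dz F j * dz F i = 0 := by
    intro i j
    rw [dz, dz, Algebra.TensorProduct.tmul_mul_tmul, Algebra.TensorProduct.tmul_mul_tmul,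
      mul_comm (Localization.mk 1 ⟨MvPolynomial.X j, _⟩ : TLoc F m), ← TensorProduct.tmul_add,
      ExteriorAlgebra.ι_add_mul_swap, TensorProduct.tmul_zero]
  have q0 : ∀ i : Fin m, dz F i * dz F i = 0 := by
    intro i
    rw [dz, Algebra.TensorProduct.tmul_mul_tmul, ExteriorAlgebra.ι_sq_zero,
      TensorProduct.tmul_zero]
  -- `θ K` is the product of the `t_k`, `k ∈ K`
  set θ : Finset (Fin m) → XiLoc F m :=
    fun K => toLoc F m ((∏ k ∈ K, MvPolynomial.X k) ⊗ₜ 1) with hθ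
  have hC : ∀ (r : F) (p : MvPolynomial (Fin m) F),
      toLoc F m ((MvPolynomial.C r * p) ⊗ₜ 1) = r • toLoc F m (p ⊗ₜ 1) := by
    intro r p
    rw [← MvPolynomial.smul_eq_C_mul, ← map_smul]
    rfl
  have hP : toLoc F m (relPoly a ⊗ₜ 1) = ∑ i ∈ supp a, a i • θ ((supp a).erase i) := by
    rw [relPoly, TensorProduct.sum_tmul, map_sum]
    exact Finset.sum_congr rfl fun i _ => hC _ _
  have hmul : ∀ p q : MvPolynomial (Fin m) F, toLoc F m (p ⊗ₜ 1) * toLoc F m (q ⊗ₜ 1)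
      = toLoc F m ((p * q) ⊗ₜ 1) := by
    intro p q
    rw [← map_mul, Algebra.TensorProduct.tmul_mul_tmul, one_mul]
  have hA : ∀ i ∈ supp a \ S, θ (supp a \ insert i S) * toLoc F m (oprod S (u F))
      = θ ((supp a).erase i) * oprod S (dz F) := by
    intro i hi
    have e : toLoc F m (oprod S (u F)) = _ := toLoc_oprod F S id
    rw [e, ← mul_assoc, hθ]
    beta_reduce
    rw [hmul, ← prod_sdiff_mul_prod _ _ S hS i hi]
    rfl
  have hB : ∀ i ∈ supp a \ S, ∀ j ∈ S, θ (supp a \ insert i S) *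
      toLoc F m (oprod S (Function.update (u F) j (u F i)))
      = θ ((supp a).erase j) * oprod S (Function.update (dz F) j (dz F i)) := by
    intro i hi j hj
    have e := toLoc_oprod F S (Function.update id j i)
    rw [Function.comp_update, Function.comp_update, Function.comp_id, Function.comp_id] at e
    rw [e, ← mul_assoc, hθ]
    beta_reduce
    rw [hmul, prod_sdiff_mul_prod_update _ _ S hS i hi j hj]
  have hD : ∀ j ∈ S, oprod S (Function.update (dz F) j (dRel a)) = a j • oprod S (dz F) +
      ∑ i ∈ supp a \ S, a i • oprod S (Function.update (dz F) j (dz F i)) := fun j hj =>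
    oprod_update_sum (dz F) q0 q1 a (supp a) S hS j hj
  have hL : toLoc F m (relPolySuper a S) = ∑ i ∈ supp a \ S, a i •
      (θ ((supp a).erase i) * oprod S (dz F) - ∑ j ∈ S, θ ((supp a).erase j) *
        oprod S (Function.update (dz F) j (dz F i))) := by
    rw [relPolySuper, map_sum]
    refine Finset.sum_congr rfl fun i hi => ?_
    rw [map_mul, hC, smul_mul_assoc, map_sub, map_sum, mul_sub, Finset.mul_sum]
    congr 1
    exact congrArg₂ _ (hA i hi) (Finset.sum_congr rfl fun j hj => hB i hi j hj)
  rw [hL, hP, Finset.sum_congr rfl fun j hj => congrArg (_ * ·) (hD j hj)]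
  exact sum_rearrange a (supp a) S hS (fun i => θ ((supp a).erase i)) (oprod S (dz F))
    fun j i => oprod S (Function.update (dz F) j (dz F i))

end

end ReciprocalPlane

/-! The generators lie in the kernels by a computation: after substituting reciprocals, `P_L`
becomes the product of the `z_i⁻¹`, `i ∈ |L|`, times `∑ a_i z_i = 0`, and `dL` becomes `∑ a_i dz_i =
0` (`evalXi_relPolySuper`).

For the converse, the pairs `t_k, u_k` are eliminated one at a time, by induction on the set `J` of
indices and for all configurations of forms at once (`mem_relIdeal_of_evalXi_eq_zero`). If `z_k` is
proportional to some `z_j`, the relation between the two expresses `t_k, u_k` through `t_j, u_j`.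
Otherwise, let the top part of an element of the kernel be `t_k ^ (N + 1) x + t_k ^ N u_k y` with
`x, y` free of `t_k, u_k`; it has a pole of order at most `N + 1` along `z_k = 0`. Multiplying by
`z_k ^ (N + 1)` and restricting to `z_k = 0` leaves `x + dz_k y = 0`. Putting `dz_k = 0` as well
shows that `x` is in the kernel for the restricted forms, which are non-zero because `z_k` is
proportional to no `z_j`. By induction `x` is a combination of multiples of `P_{L,S}` with `L`
minimal after restriction.

Such an `L` lifts to a minimal relation `L' = L + s z_k` (`isMinimalRelation_lift`). If `s ≠ 0`,
then `P_{L',S}` is `t_k P_{L,S}` up to terms free of `t_k`, and `P_{L',S ∪ {k}}` is `u_k P_{L,S}` up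
to terms free of `t_k` and `u_k`. The first identity trades `t_k ^ (N + 1) x` for `t_k ^ N x₁ + t_k
^ N u_k y₁`. Now `dz_k (y + y₁) = 0` on the hyperplane, so `y + y₁` is a multiple of `dz_k` there
and vanishes modulo `dz_k`; the second identity then removes the `u_k` term, and the order drops to
`N`.

The result for `I` follows from that for `K` by setting all `u_i = 0`, which kills `P_{L,S}` for
non-empty `S` and leaves `P_L` (`ker_h`). -/

open scoped TensorProduct

namespace ReciprocalPlane

noncomputable section

/-! ### Evaluation homomorphisms on `Ξ` -/

/-- The generator `t_i` of `Ξ`. -/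
def tVar (F : Type*) [Field F] {m : ℕ} (i : Fin m) : Xi F m :=
  MvPolynomial.X i ⊗ₜ 1

/-- The homomorphism `Ξ → B ⊗ Λ[dx_1, …, dx_n]`, `t_i ↦ τ_i`, `u_i ↦ τ_i ∑_j c i j dx_j`. -/
def evalXi {F : Type*} [Field F] {n m : ℕ} {B : Type*} [CommRing B] [Algebra F B]
    (τ : Fin m → B) (c : Fin m → Fin n → F) :
    Xi F m →ₐ[F] B ⊗[F] ExteriorAlgebra F (Fin n → F) :=
  Algebra.TensorProduct.lift (Algebra.TensorProduct.includeLeft.comp (MvPolynomial.aeval τ))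
    (ExteriorAlgebra.lift F
      ⟨Fintype.linearCombination F fun i => τ i ⊗ₜ[F] ExteriorAlgebra.ι F (c i), fun v => by
        rw [Fintype.linearCombination_apply]
        refine sq_sum_eq_zero (B := B ⊗[F] ExteriorAlgebra F (Fin n → F)) Finset.univ
          (fun i => v i • τ i ⊗ₜ[F] ExteriorAlgebra.ι F (c i)) ?_ ?_
        · intro i
          rw [smul_mul_smul_comm, Algebra.TensorProduct.tmul_mul_tmul,
            ExteriorAlgebra.ι_sq_zero, TensorProduct.tmul_zero, smul_zero]
        · intro i j
          rw [smul_mul_smul_comm, smul_mul_smul_comm, mul_comm (v j), ← smul_add,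
            Algebra.TensorProduct.tmul_mul_tmul, Algebra.TensorProduct.tmul_mul_tmul,
            mul_comm (τ j), ← TensorProduct.tmul_add, ExteriorAlgebra.ι_add_mul_swap,
            TensorProduct.tmul_zero, smul_zero]⟩)
    (fun p q => by
      change Commute ((MvPolynomial.aeval τ p) ⊗ₜ[F] (1 : ExteriorAlgebra F (Fin n → F))) _
      generalize ExteriorAlgebra.lift F (A := B ⊗[F] ExteriorAlgebra F (Fin n → F)) _ q = y
      induction y using TensorProduct.induction_on with
      | zero => exact Commute.zero_right _
      | tmul a b =>
        simp [Commute, SemiconjBy, Algebra.TensorProduct.tmul_mul_tmul, mul_comm]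
      | add a b ha hb => exact ha.add_right hb)

section

variable {F : Type*} [Field F] {n m : ℕ} {B : Type*} [CommRing B] [Algebra F B]

theorem evalXi_left (τ : Fin m → B) (c : Fin m → Fin n → F) (p : MvPolynomial (Fin m) F) :
    evalXi τ c (p ⊗ₜ 1) = MvPolynomial.aeval τ p ⊗ₜ 1 := by
  simp [evalXi]

@[simp]
theorem evalXi_tVar (τ : Fin m → B) (c : Fin m → Fin n → F) (i : Fin m) :
    evalXi τ c (tVar F i) = τ i ⊗ₜ 1 := by
  simp [tVar, evalXi_left]

@[simp]
theorem evalXi_u (τ : Fin m → B) (c : Fin m → Fin n → F) (i : Fin m) :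
    evalXi τ c (u F i) = τ i ⊗ₜ ExteriorAlgebra.ι F (c i) := by
  simp [evalXi, u, Fintype.linearCombination_apply_single, ← Algebra.TensorProduct.one_def]

/-! ### Subalgebras of `Ξ` supported on a set of indices. -/

/-- The subalgebra of `Ξ` generated by the `t_i` and `u_i` with `i ∈ J`. -/
def xiOn (F : Type*) [Field F] {m : ℕ} (J : Finset (Fin m)) : Subalgebra F (Xi F m) :=
  Algebra.adjoin F (tVar F '' J ∪ u F '' J)

theorem tVar_mem {J : Finset (Fin m)} {i : Fin m} (hi : i ∈ J) : tVar F i ∈ xiOn F J :=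
  Algebra.subset_adjoin (Or.inl ⟨i, hi, rfl⟩)

theorem u_mem {J : Finset (Fin m)} {i : Fin m} (hi : i ∈ J) : u F i ∈ xiOn F J :=
  Algebra.subset_adjoin (Or.inr ⟨i, hi, rfl⟩)

theorem xiOn_mono {J J' : Finset (Fin m)} (hJ : J ⊆ J') : xiOn F J ≤ xiOn F J' :=
  Algebra.adjoin_mono (Set.union_subset_union (Set.image_mono hJ) (Set.image_mono hJ))

theorem xiOn_le {J : Finset (Fin m)} {A : Subalgebra F (Xi F m)} (ht : ∀ i ∈ J, tVar F i ∈ A)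
    (hu : ∀ i ∈ J, u F i ∈ A) : xiOn F J ≤ A := by
  refine Algebra.adjoin_le ?_
  rintro _ (⟨i, hi, rfl⟩ | ⟨i, hi, rfl⟩)
  exacts [ht i hi, hu i hi]

theorem xiOn_eqOn {C : Type*} [Ring C] [Algebra F C] {J : Finset (Fin m)} {f g : Xi F m →ₐ[F] C}
    (ht : ∀ i ∈ J, f (tVar F i) = g (tVar F i)) (hu : ∀ i ∈ J, f (u F i) = g (u F i))
    {x : Xi F m} (hx : x ∈ xiOn F J) : f x = g x :=
  xiOn_le (A := AlgHom.equalizer f g) ht hu hx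

theorem left_mem {J S : Finset (Fin m)} (hS : S ⊆ J) (r : F) :
    (MvPolynomial.C r * ∏ k ∈ S, MvPolynomial.X k) ⊗ₜ 1 ∈ xiOn F J := by
  change MvPolynomial.C r * ∏ k ∈ S, MvPolynomial.X k ∈ (xiOn F J).comap
    (Algebra.TensorProduct.includeLeft : MvPolynomial (Fin m) F →ₐ[F] Xi F m)
  exact Subalgebra.mul_mem _ (Subalgebra.algebraMap_mem _ r)
    (Subalgebra.prod_mem _ fun k hk => tVar_mem (hS hk))

theorem xiOn_univ : xiOn F (Finset.univ : Finset (Fin m)) = ⊤ := by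
  have hl : ∀ p : MvPolynomial (Fin m) F, p ⊗ₜ 1 ∈ xiOn F (Finset.univ : Finset (Fin m)) := by
    intro p
    have : (⊤ : Subalgebra F (MvPolynomial (Fin m) F)) ≤
        (xiOn F Finset.univ).comap
          (Algebra.TensorProduct.includeLeft : MvPolynomial (Fin m) F →ₐ[F] Xi F m) := by
      rw [← MvPolynomial.adjoin_range_X]
      refine Algebra.adjoin_le ?_
      rintro _ ⟨i, rfl⟩
      exact tVar_mem (Finset.mem_univ i)
    exact this (Algebra.mem_top (x := p))
  have hr : ∀ q : ExteriorAlgebra F (Fin m → F),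
      (1 ⊗ₜ q : Xi F m) ∈ xiOn F Finset.univ := by
    intro q
    change q ∈ (xiOn F (Finset.univ : Finset (Fin m))).comap
      (Algebra.TensorProduct.includeRight : ExteriorAlgebra F (Fin m → F) →ₐ[F] Xi F m)
    induction q using ExteriorAlgebra.induction with
    | algebraMap r => exact Subalgebra.algebraMap_mem _ r
    | ι v =>
      rw [← Finset.univ_sum_single v, map_sum]
      refine Subalgebra.sum_mem _ fun i _ => ?_
      have e : (Pi.single i (v i) : Fin m → F) = v i • Pi.single i 1 := by
        rw [← Pi.single_smul', smul_eq_mul, mul_one]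
      have hu : ExteriorAlgebra.ι F (Pi.single i 1) ∈ (xiOn F (Finset.univ : Finset (Fin m))).comap
          (Algebra.TensorProduct.includeRight : ExteriorAlgebra F (Fin m → F) →ₐ[F] Xi F m) :=
        u_mem (F := F) (Finset.mem_univ i)
      rw [e, map_smul]
      exact Subalgebra.smul_mem _ hu _
    | mul a b ha hb => exact Subalgebra.mul_mem _ ha hb
    | add a b ha hb => exact Subalgebra.add_mem _ ha hb
  refine eq_top_iff.2 fun x _ => ?_
  induction x using TensorProduct.induction_on with
  | zero => exact Subalgebra.zero_mem _
  | tmul p q =>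
    have := Subalgebra.mul_mem _ (hl p) (hr q)
    rwa [Algebra.TensorProduct.tmul_mul_tmul, one_mul, mul_one] at this
  | add a b ha hb => exact Subalgebra.add_mem _ (ha trivial) (hb trivial)

theorem tVar_commute (i : Fin m) (x : Xi F m) : Commute (tVar F i) x := by
  induction x using TensorProduct.induction_on with
  | zero => exact Commute.zero_right _
  | tmul a b =>
    simp [tVar, Commute, SemiconjBy, Algebra.TensorProduct.tmul_mul_tmul, mul_comm]
  | add a b ha hb => exact ha.add_right hb

theorem u_mul_self (i : Fin m) : u F i * u F i = 0 := by
  rw [u, Algebra.TensorProduct.tmul_mul_tmul, ExteriorAlgebra.ι_sq_zero, TensorProduct.tmul_zero]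

theorem u_mul_swap (i j : Fin m) : u F i * u F j = -(u F j * u F i) := by
  rw [eq_neg_iff_add_eq_zero, u, u, Algebra.TensorProduct.tmul_mul_tmul,
    Algebra.TensorProduct.tmul_mul_tmul, ← TensorProduct.tmul_add,
    ExteriorAlgebra.ι_add_mul_swap, TensorProduct.tmul_zero]

/-- The element `y` is `x` with every `u_j` replaced by `-u_j`. Later arguments need only that it
stays in the same subalgebra, so no grading has to be tracked. -/
theorem exists_mul_u {J : Finset (Fin m)} (i : Fin m) {x : Xi F m} (hx : x ∈ xiOn F J) :
    ∃ y ∈ xiOn F J, x * u F i = u F i * y := by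
  induction hx using Algebra.adjoin_induction with
  | mem x hx =>
    obtain ⟨j, hj, rfl⟩ | ⟨j, hj, rfl⟩ := hx
    · exact ⟨_, tVar_mem hj, tVar_commute j _⟩
    · exact ⟨_, Subalgebra.neg_mem _ (u_mem hj),
        (u_mul_swap j i).trans (mul_neg (u F i) (u F j)).symm⟩
  | algebraMap r => exact ⟨_, Subalgebra.algebraMap_mem _ r, Algebra.commutes r _⟩
  | add a b _ _ ha hb =>
    obtain ⟨a', ha', ea⟩ := ha
    obtain ⟨b', hb', eb⟩ := hb
    exact ⟨_, Subalgebra.add_mem _ ha' hb', by rw [add_mul, mul_add, ea, eb]⟩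
  | mul a b _ _ ha hb =>
    obtain ⟨a', ha', ea⟩ := ha
    obtain ⟨b', hb', eb⟩ := hb
    exact ⟨_, Subalgebra.mul_mem _ ha' hb', by rw [mul_assoc, eb, ← mul_assoc, ea, mul_assoc]⟩

theorem exists_u_mul {J : Finset (Fin m)} (i : Fin m) {x : Xi F m} (hx : x ∈ xiOn F J) :
    ∃ y ∈ xiOn F J, u F i * x = y * u F i := by
  induction hx using Algebra.adjoin_induction with
  | mem x hx =>
    obtain ⟨j, hj, rfl⟩ | ⟨j, hj, rfl⟩ := hx
    · exact ⟨_, tVar_mem hj, (tVar_commute j _).symm⟩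
    · exact ⟨_, Subalgebra.neg_mem _ (u_mem hj),
        (u_mul_swap i j).trans (neg_mul (u F j) (u F i)).symm⟩
  | algebraMap r => exact ⟨_, Subalgebra.algebraMap_mem _ r, (Algebra.commutes r _).symm⟩
  | add a b _ _ ha hb =>
    obtain ⟨a', ha', ea⟩ := ha
    obtain ⟨b', hb', eb⟩ := hb
    exact ⟨_, Subalgebra.add_mem _ ha' hb', by rw [add_mul, mul_add, ea, eb]⟩
  | mul a b _ _ ha hb =>
    obtain ⟨a', ha', ea⟩ := ha
    obtain ⟨b', hb', eb⟩ := hb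
    exact ⟨_, Subalgebra.mul_mem _ ha' hb', by rw [← mul_assoc, ea, mul_assoc, eb, mul_assoc]⟩

/-! ### Ordered products. -/

theorem oprod_mem {C : Type*} [Ring C] [Algebra F C] (A : Subalgebra F C) {S : Finset (Fin m)}
    {f : Fin m → C} (hf : ∀ i ∈ S, f i ∈ A) : oprod S f ∈ A := by
  refine Subalgebra.list_prod_mem _ fun x hx => ?_
  obtain ⟨i, hi, rfl⟩ := List.mem_map.1 hx
  exact hf i ((Finset.mem_sort _).1 hi)

theorem oprod_insert_min {C : Type*} [Monoid C] {S : Finset (Fin m)} {k : Fin m}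
    (hk : ∀ i ∈ S, k < i) (f : Fin m → C) : oprod (insert k S) f = f k * oprod S f := by
  rw [oprod, Finset.sort_insert (r := (· ≤ ·)) (fun i hi => (hk i hi).le)
    (fun h => lt_irrefl _ (hk k h)),
    List.map_cons, List.prod_cons, oprod]

theorem oprod_congr {C : Type*} [Monoid C] {S : Finset (Fin m)} {f g : Fin m → C}
    (hfg : ∀ i ∈ S, f i = g i) : oprod S f = oprod S g := by
  rw [oprod, oprod, List.map_congr_left fun i hi => hfg i ((Finset.mem_sort _).1 hi)]

theorem map_oprod {C D G : Type*} [Monoid C] [Monoid D] [FunLike G C D] [MonoidHomClass G C D]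
    (g : G) (S : Finset (Fin m)) (f : Fin m → C) : g (oprod S f) = oprod S (g ∘ f) := by
  rw [oprod, oprod, map_list_prod, List.map_map]

/-- The factor `u_k` is moved to the front by anticommutation; the sign and the remaining `u_i` are
absorbed into `y`. -/
theorem oprod_update_u {J S : Finset (Fin m)} (hS : S ⊆ J) {j : Fin m} (hj : j ∈ S) (k : Fin m) :
    ∃ y ∈ xiOn F J, oprod S (Function.update (u F) j (u F k)) = u F k * y := by
  have key : ∀ l : List (Fin m), l.Nodup → (∀ i ∈ l, i ∈ J) → j ∈ l → ∃ y ∈ xiOn F J,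
      (l.map (Function.update (u F) j (u F k))).prod = u F k * y := by
    intro l
    induction l with
    | nil => intro _ _ h; simp at h
    | cons x l ih =>
      intro hn hl hjl
      rw [List.map_cons, List.prod_cons]
      rw [List.nodup_cons] at hn
      by_cases hx : x = j
      · subst hx
        refine ⟨_, ?_, by rw [Function.update_self]⟩
        refine Subalgebra.list_prod_mem _ fun y hy => ?_
        obtain ⟨i, hi, rfl⟩ := List.mem_map.1 hy
        rw [Function.update_of_ne (fun h : i = x => hn.1 (h ▸ hi))]
        exact u_mem (hl i (List.mem_cons_of_mem _ hi))
      · have hjl' : j ∈ l := by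
          rcases List.mem_cons.1 hjl with h | h
          exacts [absurd h.symm hx, h]
        obtain ⟨y, hy, e⟩ := ih hn.2 (fun i hi => hl i (List.mem_cons_of_mem _ hi)) hjl'
        refine ⟨-(u F x * y), Subalgebra.neg_mem _
          (Subalgebra.mul_mem _ (u_mem (hl x List.mem_cons_self)) hy), ?_⟩
        rw [e, Function.update_of_ne hx, ← mul_assoc, u_mul_swap]
        refine (neg_mul (u F k * u F x) y).trans ?_
        rw [mul_assoc]
        exact (mul_neg (u F k) (u F x * y)).symm
  exact key _ (Finset.sort_nodup _ _) (fun i hi => hS ((Finset.mem_sort _).1 hi))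
    ((Finset.mem_sort _).2 hj)

end

/-! ### Linear forms and relations -/

section

variable {F : Type*} [Field F] {n m : ℕ}

/-- The linear form with a given coefficient vector. -/
def linPoly (F : Type*) [Field F] (n : ℕ) : (Fin n → F) →ₗ[F] MvPolynomial (Fin n) F :=
  Fintype.linearCombination F MvPolynomial.X

theorem linPoly_injective : Function.Injective (linPoly F n) := by
  have h := MvPolynomial.linearIndependent_X (σ := Fin n) (R := F)
  exact (linearIndependent_iff_injective_fintypeLinearCombination).1 h

theorem linForm_eq (c : Fin m → Fin n → F) (i : Fin m) : linForm c i = linPoly F n (c i) := by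
  simp [linForm, linPoly, Fintype.linearCombination_apply, MvPolynomial.smul_eq_C_mul]

theorem isRelation_iff {c : Fin m → Fin n → F} {a : Fin m → F} :
    IsRelation c a ↔ a ≠ 0 ∧ ∑ i, a i • c i = 0 := by
  have e : ∑ i, MvPolynomial.C (a i) * linForm c i = linPoly F n (∑ i, a i • c i) := by
    simp [linForm_eq, MvPolynomial.smul_eq_C_mul]
  rw [IsRelation, e, map_eq_zero_iff _ linPoly_injective]

@[simp]
theorem mem_supp {a : Fin m → F} {i : Fin m} : i ∈ supp a ↔ a i ≠ 0 := by
  simp [supp]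

theorem sum_supp {E : Type*} [AddCommGroup E] [Module F E] (a : Fin m → F) (w : Fin m → E) :
    ∑ i ∈ supp a, a i • w i = ∑ i, a i • w i := by
  refine Finset.sum_subset (Finset.subset_univ _) fun i _ hi => ?_
  rw [mem_supp, not_not] at hi
  rw [hi, zero_smul]

/-- Subtracting a suitable multiple of a vector with smaller support decreases the support. -/
theorem exists_supp_sub_ssubset {a b : Fin m → F} (hb : b ≠ 0) (hab : supp b ⊆ supp a) :
    ∃ r : F, r ≠ 0 ∧ supp (a - r • b) ⊂ supp a := by
  obtain ⟨i, hi⟩ := Function.ne_iff.1 hb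
  have hi' : b i ≠ 0 := hi
  have hai : a i ≠ 0 := mem_supp.1 (hab (mem_supp.2 hi'))
  refine ⟨a i / b i, div_ne_zero hai hi', Finset.ssubset_iff_subset_ne.2 ⟨fun k hk => ?_, ?_⟩⟩
  · by_contra hk'
    have hbk : b k = 0 := by
      by_contra h
      exact hk' (hab (mem_supp.2 h))
    rw [mem_supp, not_not] at hk'
    simp [hk', hbk] at hk
  · intro h
    have : i ∈ supp (a - (a i / b i) • b) := h ▸ mem_supp.2 hai
    simp [hi'] at this

/-- A relation is minimal if and only if its support contains no smaller support of a relation. -/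
theorem isMinimalRelation_iff {c : Fin m → Fin n → F} {a : Fin m → F} :
    IsMinimalRelation c a ↔ IsRelation c a ∧ ∀ b, IsRelation c b → ¬ supp b ⊂ supp a := by
  refine and_congr_right fun ha => ⟨fun h b hb hba => h ?_, ?_⟩
  · obtain ⟨r, hr, hs⟩ := exists_supp_sub_ssubset hb.1 hba.1
    have e : supp (r • b) = supp b := by ext i; simp [hr]
    rw [isRelation_iff] at ha hb
    refine ⟨a - r • b, r • b, isRelation_iff.2 ⟨fun h0 => ?_, ?_⟩,
      isRelation_iff.2 ⟨smul_ne_zero hr hb.1, ?_⟩, by simp, hs, by rwa [e]⟩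
    · rw [sub_eq_zero] at h0
      rw [h0, e] at hba
      exact hba.2 subset_rfl
    · simp [sub_smul, mul_smul, Finset.sum_sub_distrib, ← Finset.smul_sum, ha.2, hb.2]
    · simp [mul_smul, ← Finset.smul_sum, hb.2]
  · rintro h ⟨a₁, _, h₁, _, _, hs, _⟩
    exact h a₁ h₁ hs

/-- The relation between two parallel vectors is minimal. -/
theorem isMinimalRelation_of_parallel {c : Fin m → Fin n → F} {j k : Fin m} (hjk : j ≠ k)
    (hj : c j ≠ 0) (hk : c k ≠ 0) {b : F} (h : c j = b • c k) :
    IsMinimalRelation c (Pi.single j 1 - Pi.single k b) := by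
  have hb : b ≠ 0 := by rintro rfl; exact hj (by simpa using h)
  rw [isMinimalRelation_iff, isRelation_iff]
  refine ⟨⟨fun h0 => ?_, ?_⟩, fun a ha hs => ?_⟩
  · have := congrFun h0 j
    simp [hjk] at this
  · simp [sub_smul, Finset.sum_sub_distrib, Pi.single_apply, ite_smul, h]
  · rw [isRelation_iff] at ha
    have hz : ∀ i, i ≠ j → i ≠ k → a i = 0 := by
      intro i h1 h2
      by_contra h3
      have := hs.1 (mem_supp.2 h3)
      simp [h1, h2] at this
    have hsum : a j • c j + a k • c k = 0 := by
      rw [← ha.2, Finset.sum_eq_add j k hjk (fun i _ hi => by rw [hz i hi.1 hi.2, zero_smul])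
        (by simp) (by simp)]
    have h1 : a j = 0 ↔ a k = 0 := by
      constructor
      · intro h; simpa [h, hk] using hsum
      · intro h; simpa [h, hj] using hsum
    by_cases h2 : a j = 0
    · refine ha.1 (funext fun i => ?_)
      by_cases hij : i = j
      · rw [hij, h2]; rfl
      · by_cases hik : i = k
        · rw [hik, h1.1 h2]; rfl
        · exact hz i hij hik
    · refine hs.2 fun i hi => ?_
      by_cases hij : i = j
      · rw [hij]; exact mem_supp.2 h2
      · by_cases hik : i = k
        · rw [hik]; exact mem_supp.2 fun h => h2 (h1.2 h)
        · simp [hij, hik] at hi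

/-- A minimal relation of the projection of the `c i` along `c k` lifts to a minimal relation. -/
theorem isMinimalRelation_lift {c : Fin m → Fin n → F} {k : Fin m} (hk : c k ≠ 0)
    {π : (Fin n → F) →ₗ[F] (Fin n → F)} (hπ : ∀ v, π v = 0 ↔ ∃ r : F, v = r • c k)
    {a : Fin m → F} (hak : a k = 0) (ha : IsMinimalRelation (fun i => π (c i)) a) :
    ∃ s : F, IsMinimalRelation c (Function.update a k s) := by
  rw [isMinimalRelation_iff, isRelation_iff] at ha
  obtain ⟨⟨ha0, has⟩, hmin⟩ := ha
  have hup : ∀ (b : Fin m → F) (s : F),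
      ∑ i, Function.update b k s i • c i = ∑ i, b i • c i + (s - b k) • c k := by
    intro b s
    have e : Function.update b k s = b + Pi.single k (s - b k) := by
      ext i
      by_cases hi : i = k
      · subst hi; simp
      · simp [hi]
    rw [e]
    simp [add_smul, Finset.sum_add_distrib, Pi.single_apply, ite_smul]
  have hπs : ∀ b : Fin m → F, ∑ i, b i • π (c i) = π (∑ i, b i • c i) := by simp
  rw [hπs, hπ] at has
  obtain ⟨r, hr⟩ := has
  -- The vectors satisfy `∑ a_i c_i = r c_k`, so the coefficient at `k` must be `-r`.
  refine ⟨-r, isMinimalRelation_iff.2 ⟨isRelation_iff.2 ⟨fun h0 => ha0 ?_, ?_⟩, ?_⟩⟩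
  · ext i
    by_cases hi : i = k
    · rw [hi, hak]; rfl
    · simpa [hi] using congrFun h0 i
  · rw [hup, hr, hak, sub_zero, ← add_smul, add_neg_cancel, zero_smul]
  intro b hb hs
  rw [isRelation_iff] at hb
  have hπk : π (c k) = 0 := (hπ _).2 ⟨1, (one_smul _ _).symm⟩
  -- Dropping the coefficient at `k` turns a relation `b` of the `c i` into one of their
  -- projections. Minimality of `a` then forces its support to be all of `supp a`.
  have hb' : IsRelation (fun i => π (c i)) (Function.update b k 0) := by
    refine isRelation_iff.2 ⟨fun h0 => ?_, ?_⟩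
    · have hbi : ∀ i, i ≠ k → b i = 0 := fun i hi => by simpa [hi] using congrFun h0 i
      have h1 := hb.2
      rw [Finset.sum_eq_single_of_mem k (Finset.mem_univ k)
        (fun i _ hi => by rw [hbi i hi, zero_smul])] at h1
      refine hb.1 (funext fun i => ?_)
      by_cases hi : i = k
      · rw [hi]; simpa [hk] using h1
      · exact hbi i hi
    · rw [hπs, hup, hb.2, zero_add, map_smul, hπk, smul_zero]
  have hsub : supp (Function.update b k 0) ⊆ supp a := by
    intro i hi
    by_cases hik : i = k
    · simp [hik] at hi
    · have := hs.1 (show i ∈ supp b by simpa [hik] using hi)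
      simpa [hik] using this
  have heq : supp a ⊆ supp (Function.update b k 0) := by
    by_contra h
    exact hmin _ hb' ⟨hsub, h⟩
  have hbk : b k = 0 := by
    by_contra h
    refine hs.2 fun i hi => ?_
    by_cases hik : i = k
    · rw [hik]; exact mem_supp.2 h
    · have := heq (show i ∈ supp a by simpa [hik] using hi)
      simpa [hik] using this
  have hbu : Function.update b k 0 = b := by rw [← hbk, Function.update_eq_self]
  rw [hbu] at hsub heq
  obtain ⟨q, hq, hq'⟩ := exists_supp_sub_ssubset hb.1 hsub
  -- Otherwise this is a relation of the projections with support smaller than that of `a`. Hence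
  -- `a` is proportional to the relation `b`, which gives `r = 0`: the lift is `a` itself and its
  -- support is not larger than that of `b`.
  have h0 : a - q • b = 0 := by
    by_contra h0
    refine hmin _ (isRelation_iff.2 ⟨h0, ?_⟩) hq'
    have e : ∑ i, (a - q • b) i • c i = r • c k := by
      simp [sub_smul, mul_smul, Finset.sum_sub_distrib, ← Finset.smul_sum, hr, hb.2]
    rw [hπs, e, map_smul, hπk, smul_zero]
  have hr0 : r • c k = 0 := by
    rw [← hr, sub_eq_zero.1 h0]
    simp [mul_smul, ← Finset.smul_sum, hb.2]
  have hr0' : r = 0 := by simpa [hk] using hr0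
  refine hs.2 fun i hi => heq ?_
  by_cases hik : i = k
  · subst hik; simp [hr0'] at hi
  · simpa [hik] using hi

/-! ### The elements `P_{L,S}` -/

theorem relPolySuper_empty (a : Fin m → F) : relPolySuper a ∅ = relPoly a ⊗ₜ 1 := by
  rw [relPolySuper, relPoly, TensorProduct.sum_tmul, Finset.sdiff_empty]
  refine Finset.sum_congr rfl fun i _ => ?_
  have e : oprod ∅ (u F : Fin m → Xi F m) = 1 := by simp [oprod]
  rw [e, Finset.sum_empty, sub_zero, mul_one, insert_empty_eq, Finset.sdiff_singleton_eq_erase]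

/-- Here `y i` stands for `z_i`. Since `u_i ↦ τ_i v_i` with `v_i = dz_i`, the expansion of `P_{L,S}`
can be folded back into the form with `P_L` and `dL`, exactly as in `toLoc_relPolySuper`; then both
`P_L` and `dL` evaluate to zero. -/
theorem evalXi_relPolySuper {B : Type*} [CommRing B] [Algebra F B] (τ y : Fin m → B)
    (c : Fin m → Fin n → F) {a : Fin m → F} (hy : ∀ i ∈ supp a, τ i * y i = 1)
    (hsum : ∑ i ∈ supp a, a i • y i = 0) (hc : ∑ i ∈ supp a, a i • c i = 0)
    {S : Finset (Fin m)} (hS : S ⊆ supp a) : evalXi τ c (relPolySuper a S) = 0 := by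
  set v : Fin m → B ⊗[F] ExteriorAlgebra F (Fin n → F) :=
    fun i => 1 ⊗ₜ ExteriorAlgebra.ι F (c i) with hv
  have q1 : ∀ i j, v i * v j + v j * v i = 0 := by
    intro i j
    simp only [hv, Algebra.TensorProduct.tmul_mul_tmul]
    rw [← TensorProduct.tmul_add, ExteriorAlgebra.ι_add_mul_swap, TensorProduct.tmul_zero]
  have q0 : ∀ i, v i * v i = 0 := by
    intro i
    simp only [hv, Algebra.TensorProduct.tmul_mul_tmul]
    rw [ExteriorAlgebra.ι_sq_zero, TensorProduct.tmul_zero]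
  have hv0 : ∑ i ∈ supp a, a i • v i = 0 := by
    have : ∑ i ∈ supp a, a i • v i =
        1 ⊗ₜ ExteriorAlgebra.ι F (∑ i ∈ supp a, a i • c i) := by
      simp [hv, TensorProduct.tmul_sum]
    rw [this, hc, map_zero, TensorProduct.tmul_zero]
  set θ : Finset (Fin m) → B ⊗[F] ExteriorAlgebra F (Fin n → F) :=
    fun K => (∏ k ∈ K, τ k) ⊗ₜ 1 with hθ
  have hu : ∀ g : Fin m → Fin m, evalXi τ c (oprod S (u F ∘ g)) =
      ((∏ k ∈ S, τ (g k)) ⊗ₜ 1) * oprod S (v ∘ g) := by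
    intro g
    have e1 : oprod S (evalXi τ c ∘ u F ∘ g) = (∏ k ∈ S, τ (g k)) ⊗ₜ[F]
        oprod S (fun k => ExteriorAlgebra.ι F (c (g k))) := by
      rw [← oprod_tmul]
      exact oprod_congr fun i _ => evalXi_u τ c (g i)
    have e2 : oprod S (v ∘ g) = (∏ k ∈ S, (1 : B)) ⊗ₜ[F]
        oprod S (fun k => ExteriorAlgebra.ι F (c (g k))) := oprod_tmul S (fun _ => 1) _
    rw [map_oprod, e1, e2, Algebra.TensorProduct.tmul_mul_tmul, Finset.prod_const_one, mul_one,
      one_mul]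
  have hC : ∀ (r : F) (K : Finset (Fin m)),
      evalXi τ c ((MvPolynomial.C r * ∏ k ∈ K, MvPolynomial.X k) ⊗ₜ 1) = r • θ K := by
    intro r K
    rw [evalXi_left, map_mul, map_prod, hθ]
    simp [Algebra.smul_def, Algebra.TensorProduct.algebraMap_apply,
      Algebra.TensorProduct.tmul_mul_tmul]
  have hA : ∀ i ∈ supp a \ S, θ (supp a \ insert i S) * evalXi τ c (oprod S (u F))
      = θ ((supp a).erase i) * oprod S v := by
    intro i hi
    have e : evalXi τ c (oprod S (u F)) = _ := hu id
    rw [e, ← mul_assoc, hθ]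
    beta_reduce
    rw [Algebra.TensorProduct.tmul_mul_tmul, one_mul, ← prod_sdiff_mul_prod _ _ S hS i hi]
    rfl
  have hB : ∀ i ∈ supp a \ S, ∀ j ∈ S, θ (supp a \ insert i S) *
      evalXi τ c (oprod S (Function.update (u F) j (u F i)))
      = θ ((supp a).erase j) * oprod S (Function.update v j (v i)) := by
    intro i hi j hj
    have e := hu (Function.update id j i)
    rw [Function.comp_update, Function.comp_update, Function.comp_id, Function.comp_id] at e
    rw [e, ← mul_assoc, hθ]
    beta_reduce
    rw [Algebra.TensorProduct.tmul_mul_tmul, one_mul,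
      prod_sdiff_mul_prod_update _ _ S hS i hi j hj]
  have hD : ∀ j ∈ S, a j • oprod S v +
      ∑ i ∈ supp a \ S, a i • oprod S (Function.update v j (v i)) = 0 := fun j hj => by
    rw [← oprod_update_sum v q0 q1 a (supp a) S hS j hj, hv0]
    obtain ⟨p, q, hpq⟩ := oprod_update_split v S j hj
    rw [hpq, mul_zero, zero_mul]
  have hL : evalXi τ c (relPolySuper a S) = ∑ i ∈ supp a \ S, a i •
      (θ ((supp a).erase i) * oprod S v - ∑ j ∈ S, θ ((supp a).erase j) *
        oprod S (Function.update v j (v i))) := by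
    rw [relPolySuper, map_sum]
    refine Finset.sum_congr rfl fun i hi => ?_
    rw [map_mul, hC, smul_mul_assoc, map_sub, map_sum, mul_sub, Finset.mul_sum]
    congr 1
    exact congrArg₂ _ (hA i hi) (Finset.sum_congr rfl fun j hj => hB i hi j hj)
  -- Omitting the factor `τ i` from the product amounts to multiplying the full product by `y i`.
  have hP : ∑ i ∈ supp a, a i • θ ((supp a).erase i) = 0 := by
    have e : ∀ i ∈ supp a, a i • θ ((supp a).erase i) =
        ((∏ k ∈ supp a, τ k) * (a i • y i)) ⊗ₜ 1 := by
      intro i hi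
      rw [hθ, TensorProduct.smul_tmul', ← Finset.mul_prod_erase _ _ hi, mul_smul_comm,
        mul_right_comm, hy i hi, one_mul]
    rw [Finset.sum_congr rfl e, ← TensorProduct.sum_tmul, ← Finset.mul_sum, hsum, mul_zero,
      TensorProduct.zero_tmul]
  rw [hL, sum_rearrange a (supp a) S hS (fun i => θ ((supp a).erase i)) (oprod S v)
    fun j i => oprod S (Function.update v j (v i)), hP, zero_mul, zero_sub, neg_eq_zero]
  exact Finset.sum_eq_zero fun j hj => by rw [hD j hj, mul_zero]

end

/-! ### The ideal generated by the `P_{L,S}` -/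

section

variable {F : Type*} [Field F] {n m : ℕ}

/-- The two-sided ideal of the subalgebra of `Ξ` generated by the `t_i` and `u_i`, `i ∈ J`, that is
generated by the `P_{L,S}` with `L` minimal and `|L| ⊆ J`. -/
def relIdeal (c : Fin m → Fin n → F) (J : Finset (Fin m)) : Submodule F (Xi F m) :=
  Submodule.span F {f | ∃ (a : Fin m → F) (S : Finset (Fin m)) (x y : Xi F m),
    IsMinimalRelation c a ∧ supp a ⊆ J ∧ S ⊆ supp a ∧ x ∈ xiOn F J ∧ y ∈ xiOn F J ∧
      f = x * relPolySuper a S * y}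

theorem relPolySuper_mem_relIdeal {c : Fin m → Fin n → F} {J : Finset (Fin m)} {a : Fin m → F}
    (ha : IsMinimalRelation c a) (hJ : supp a ⊆ J) {S : Finset (Fin m)} (hS : S ⊆ supp a) :
    relPolySuper a S ∈ relIdeal c J :=
  Submodule.subset_span ⟨a, S, 1, 1, ha, hJ, hS, Subalgebra.one_mem _, Subalgebra.one_mem _,
    by rw [one_mul, mul_one]⟩

theorem mul_mem_relIdeal {c : Fin m → Fin n → F} {J : Finset (Fin m)} {x f : Xi F m}
    (hx : x ∈ xiOn F J) (hf : f ∈ relIdeal c J) : x * f ∈ relIdeal c J := by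
  induction hf using Submodule.span_induction with
  | mem f hf =>
    obtain ⟨a, S, p, q, ha, hJ, hS, hp, hq, rfl⟩ := hf
    exact Submodule.subset_span ⟨a, S, x * p, q, ha, hJ, hS, Subalgebra.mul_mem _ hx hp, hq,
      by simp only [mul_assoc]⟩
  | zero => rw [mul_zero]; exact Submodule.zero_mem _
  | add f g _ _ hf hg => rw [mul_add]; exact Submodule.add_mem _ hf hg
  | smul r f _ hf => rw [mul_smul_comm]; exact Submodule.smul_mem _ _ hf

theorem relIdeal_mul_mem {c : Fin m → Fin n → F} {J : Finset (Fin m)} {x f : Xi F m}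
    (hx : x ∈ xiOn F J) (hf : f ∈ relIdeal c J) : f * x ∈ relIdeal c J := by
  induction hf using Submodule.span_induction with
  | mem f hf =>
    obtain ⟨a, S, p, q, ha, hJ, hS, hp, hq, rfl⟩ := hf
    exact Submodule.subset_span ⟨a, S, p, q * x, ha, hJ, hS, hp, Subalgebra.mul_mem _ hq hx,
      by simp only [mul_assoc]⟩
  | zero => rw [zero_mul]; exact Submodule.zero_mem _
  | add f g _ _ hf hg => rw [add_mul]; exact Submodule.add_mem _ hf hg
  | smul r f _ hf => rw [smul_mul_assoc]; exact Submodule.smul_mem _ _ hf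

theorem relIdeal_mono (c : Fin m → Fin n → F) {J J' : Finset (Fin m)} (hJ : J ⊆ J') :
    relIdeal c J ≤ relIdeal c J' := by
  refine Submodule.span_mono ?_
  rintro _ ⟨a, S, p, q, ha, haJ, hS, hp, hq, rfl⟩
  exact ⟨a, S, p, q, ha, haJ.trans hJ, hS, xiOn_mono hJ hp, xiOn_mono hJ hq, rfl⟩

/-! ### Adding one index to the support of a relation. -/

theorem supp_update {a : Fin m → F} {k : Fin m} {s : F} (hs : s ≠ 0) :
    supp (Function.update a k s) = insert k (supp a) := by
  ext i
  by_cases hi : i = k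
  · subst hi; simp [hs]
  · simp [hi]

/-- The summand with index `k` is split off; in every other summand the enlarged support contributes
one more factor `t_k`. -/
theorem relPolySuper_update {a : Fin m → F} {k : Fin m} (hak : a k = 0) {s : F} (hs : s ≠ 0)
    {S : Finset (Fin m)} (hS : S ⊆ supp a) :
    relPolySuper (Function.update a k s) S = tVar F k * relPolySuper a S +
      (MvPolynomial.C s * ∏ i ∈ supp a \ S, MvPolynomial.X i) ⊗ₜ[F] 1 *
        (oprod S (u F) - ∑ j ∈ S, oprod S (Function.update (u F) j (u F k))) := by
  have hk : k ∉ supp a := by simp [hak]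
  have hkS : k ∉ S := fun h => hk (hS h)
  rw [relPolySuper, supp_update hs, Finset.insert_sdiff_of_notMem _ hkS,
    Finset.sum_insert (by simp [hak]), Function.update_self, add_comm, relPolySuper,
    Finset.mul_sum]
  congr 1
  · refine Finset.sum_congr rfl fun i hi => ?_
    have hik : i ≠ k := by
      rintro rfl
      exact hk (Finset.mem_sdiff.1 hi).1
    rw [Function.update_of_ne hik, ← mul_assoc, tVar, Algebra.TensorProduct.tmul_mul_tmul, one_mul,
      Finset.insert_sdiff_of_notMem _ (by simp [hkS, hik.symm]),
      Finset.prod_insert (by simp [hak]), mul_left_comm]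
  · rw [Finset.insert_sdiff_insert, Finset.sdiff_insert_of_notMem hk]

/-- Replacing `u_k` by `u_i` produces the terms without `u_k`. In all other terms `u_k` is the
leftmost factor, because `k` precedes the whole support, so no signs occur. -/
theorem relPolySuper_update_insert {a : Fin m → F} {k : Fin m} (hak : a k = 0) {s : F}
    (hs : s ≠ 0) {S : Finset (Fin m)} (hS : S ⊆ supp a) (hk : ∀ i ∈ supp a, k < i) :
    relPolySuper (Function.update a k s) (insert k S) = u F k * relPolySuper a S -
      ∑ i ∈ supp a \ S, (MvPolynomial.C (a i) * ∏ l ∈ supp a \ insert i S, MvPolynomial.X l) ⊗ₜ[F] 1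
        * (u F i * oprod S (u F)) := by
  have hk' : k ∉ supp a := by simp [hak]
  have hkS : k ∉ S := fun h => hk' (hS h)
  have hmin : ∀ i ∈ S, k < i := fun i hi => hk i (hS hi)
  rw [relPolySuper, supp_update hs, Finset.insert_sdiff_insert, Finset.sdiff_insert_of_notMem hk',
    relPolySuper, Finset.mul_sum, ← Finset.sum_sub_distrib]
  refine Finset.sum_congr rfl fun i hi => ?_
  have hik : i ≠ k := by
    rintro rfl
    exact hk' (Finset.mem_sdiff.1 hi).1
  have hcomm : ∀ (p : MvPolynomial (Fin m) F) (x : Xi F m),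
      u F k * (p ⊗ₜ 1 * x) = p ⊗ₜ 1 * (u F k * x) := by
    intro p x
    rw [← mul_assoc, ← mul_assoc, u, Algebra.TensorProduct.tmul_mul_tmul,
      Algebra.TensorProduct.tmul_mul_tmul, mul_one, one_mul, mul_one, one_mul]
  rw [Function.update_of_ne hik, Finset.insert_comm, Finset.insert_sdiff_insert,
    Finset.sdiff_insert_of_notMem hk', hcomm, ← mul_sub, Finset.sum_insert hkS,
    oprod_insert_min hmin, oprod_insert_min hmin, Function.update_self]
  have e1 : oprod S (Function.update (u F) k (u F i)) = oprod S (u F) :=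
    oprod_congr fun j hj => Function.update_of_ne (fun h : j = k => hkS (h ▸ hj)) _ _
  have e2 : ∀ j ∈ S, oprod (insert k S) (Function.update (u F) j (u F i)) =
      u F k * oprod S (Function.update (u F) j (u F i)) := by
    intro j hj
    rw [oprod_insert_min hmin, Function.update_of_ne (fun h : k = j => hkS (h ▸ hj))]
  rw [e1, Finset.sum_congr rfl e2, mul_sub (u F k), Finset.mul_sum]
  congr 1
  abel

/-! ### Lifting elements of the ideal from the hyperplane `z_k = 0`. -/

section lift

variable {c : Fin m → Fin n → F} {k : Fin m} {π : (Fin n → F) →ₗ[F] (Fin n → F)}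
  {J : Finset (Fin m)}

theorem exists_tVar_mul_relPolySuper (hck : c k ≠ 0)
    (hπ : ∀ v, π v = 0 ↔ ∃ r : F, v = r • c k) (hk : k ∉ J) {a : Fin m → F}
    (ha : IsMinimalRelation (fun i => π (c i)) a) (haJ : supp a ⊆ J) {S : Finset (Fin m)}
    (hS : S ⊆ supp a) :
    ∃ q ∈ relIdeal c (insert k J), ∃ x ∈ xiOn F J, ∃ y ∈ xiOn F J,
      tVar F k * relPolySuper a S = q + x + u F k * y := by
  have hak : a k = 0 := by
    by_contra h
    exact hk (haJ (mem_supp.2 h))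
  obtain ⟨s, hs⟩ := isMinimalRelation_lift hck hπ hak ha
  -- If `s = 0`, the relation of the projections already holds for the `c i`, and the product itself
  -- lies in the ideal.
  by_cases hs0 : s = 0
  · rw [hs0, ← hak, Function.update_eq_self] at hs
    exact ⟨_, mul_mem_relIdeal (tVar_mem (Finset.mem_insert_self _ _))
      (relPolySuper_mem_relIdeal hs (haJ.trans (Finset.subset_insert _ _)) hS), 0,
      Subalgebra.zero_mem _, 0, Subalgebra.zero_mem _, by simp⟩
  have hmem : ∀ j ∈ S, ∃ y ∈ xiOn F J,
      oprod S (Function.update (u F) j (u F k)) = u F k * y := fun j hj =>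
    oprod_update_u (hS.trans haJ) hj k
  choose! y hy hye using hmem
  have hp := left_mem (F := F) ((Finset.sdiff_subset (s := supp a) (t := S)).trans haJ) s
  set p : Xi F m := (MvPolynomial.C s * ∏ i ∈ supp a \ S, MvPolynomial.X i) ⊗ₜ[F] 1 with hpdef
  obtain ⟨p', hp', e⟩ := exists_mul_u k hp
  have hu : oprod S (u F) ∈ xiOn F J := oprod_mem _ fun i hi => u_mem (haJ (hS hi))
  refine ⟨relPolySuper (Function.update a k s) S, relPolySuper_mem_relIdeal hs ?_ ?_,
    -(p * oprod S (u F)), Subalgebra.neg_mem _ (Subalgebra.mul_mem _ hp hu),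
    p' * ∑ j ∈ S, y j, Subalgebra.mul_mem _ hp' (Subalgebra.sum_mem _ hy), ?_⟩
  · rw [supp_update hs0]; exact Finset.insert_subset_insert _ haJ
  · rw [supp_update hs0]; exact hS.trans (Finset.subset_insert _ _)
  · rw [relPolySuper_update hak hs0 hS, ← hpdef, Finset.sum_congr rfl hye, ← Finset.mul_sum,
      mul_sub, ← mul_assoc p (u F k), e, mul_assoc (u F k)]
    abel

theorem exists_u_mul_relPolySuper (hck : c k ≠ 0)
    (hπ : ∀ v, π v = 0 ↔ ∃ r : F, v = r • c k) (hk : ∀ i ∈ J, k < i) {a : Fin m → F}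
    (ha : IsMinimalRelation (fun i => π (c i)) a) (haJ : supp a ⊆ J) {S : Finset (Fin m)}
    (hS : S ⊆ supp a) :
    ∃ q ∈ relIdeal c (insert k J), ∃ x ∈ xiOn F J, u F k * relPolySuper a S = q + x := by
  have hak : a k = 0 := by
    by_contra h
    exact lt_irrefl _ (hk _ (haJ (mem_supp.2 h)))
  obtain ⟨s, hs⟩ := isMinimalRelation_lift hck hπ hak ha
  by_cases hs0 : s = 0
  · rw [hs0, ← hak, Function.update_eq_self] at hs
    exact ⟨_, mul_mem_relIdeal (u_mem (Finset.mem_insert_self _ _))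
      (relPolySuper_mem_relIdeal hs (haJ.trans (Finset.subset_insert _ _)) hS), 0,
      Subalgebra.zero_mem _, by simp⟩
  have hu : oprod S (u F) ∈ xiOn F J := oprod_mem _ fun i hi => u_mem (haJ (hS hi))
  refine ⟨relPolySuper (Function.update a k s) (insert k S), relPolySuper_mem_relIdeal hs ?_ ?_,
    _, ?_, sub_eq_iff_eq_add.1
      (relPolySuper_update_insert hak hs0 hS fun i hi => hk i (haJ hi)).symm⟩
  · rw [supp_update hs0]; exact Finset.insert_subset_insert _ haJ
  · rw [supp_update hs0]; exact Finset.insert_subset_insert _ hS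
  · exact Subalgebra.sum_mem _ fun i hi => Subalgebra.mul_mem _
      (left_mem (Finset.sdiff_subset.trans haJ) _)
      (Subalgebra.mul_mem _ (u_mem (haJ (Finset.mem_sdiff.1 hi).1)) hu)

theorem exists_tVar_mul_relIdeal (hck : c k ≠ 0)
    (hπ : ∀ v, π v = 0 ↔ ∃ r : F, v = r • c k) (hk : k ∉ J) {f : Xi F m}
    (hf : f ∈ relIdeal (fun i => π (c i)) J) :
    ∃ q ∈ relIdeal c (insert k J), ∃ x ∈ xiOn F J, ∃ y ∈ xiOn F J,
      tVar F k * f = q + x + u F k * y := by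
  induction hf using Submodule.span_induction with
  | mem f hf =>
    obtain ⟨a, S, p, p', ha, haJ, hS, hp, hp', rfl⟩ := hf
    obtain ⟨q, hq, x, hx, y, hy, e⟩ := exists_tVar_mul_relPolySuper hck hπ hk ha haJ hS
    obtain ⟨r, hr, er⟩ := exists_mul_u k hp
    have hJ : xiOn F J ≤ xiOn F (insert k J) := xiOn_mono (Finset.subset_insert _ _)
    refine ⟨p * q * p', relIdeal_mul_mem (hJ hp') (mul_mem_relIdeal (hJ hp) hq), p * x * p',
      Subalgebra.mul_mem _ (Subalgebra.mul_mem _ hp hx) hp', r * y * p',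
      Subalgebra.mul_mem _ (Subalgebra.mul_mem _ hr hy) hp', ?_⟩
    rw [← mul_assoc, ← mul_assoc, (tVar_commute k p).eq, mul_assoc p, e, mul_add, mul_add,
      ← mul_assoc p (u F k), er, add_mul, add_mul]
    simp only [mul_assoc]
  | zero =>
    exact ⟨0, Submodule.zero_mem _, 0, Subalgebra.zero_mem _, 0, Subalgebra.zero_mem _, by simp⟩
  | add f g _ _ hf hg =>
    obtain ⟨q, hq, x, hx, y, hy, e⟩ := hf
    obtain ⟨q', hq', x', hx', y', hy', e'⟩ := hg
    refine ⟨_, Submodule.add_mem _ hq hq', _, Subalgebra.add_mem _ hx hx', _,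
      Subalgebra.add_mem _ hy hy', ?_⟩
    rw [mul_add, e, e', mul_add]
    abel
  | smul r f _ hf =>
    obtain ⟨q, hq, x, hx, y, hy, e⟩ := hf
    refine ⟨_, Submodule.smul_mem _ r hq, _, Subalgebra.smul_mem _ hx r, _,
      Subalgebra.smul_mem _ hy r, ?_⟩
    rw [mul_smul_comm, e, mul_smul_comm, smul_add, smul_add]

theorem exists_u_mul_relIdeal (hck : c k ≠ 0)
    (hπ : ∀ v, π v = 0 ↔ ∃ r : F, v = r • c k) (hk : ∀ i ∈ J, k < i) {f : Xi F m}
    (hf : f ∈ relIdeal (fun i => π (c i)) J) :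
    ∃ q ∈ relIdeal c (insert k J), ∃ x ∈ xiOn F J, u F k * f = q + x := by
  induction hf using Submodule.span_induction with
  | mem f hf =>
    obtain ⟨a, S, p, p', ha, haJ, hS, hp, hp', rfl⟩ := hf
    obtain ⟨q, hq, x, hx, e⟩ := exists_u_mul_relPolySuper hck hπ hk ha haJ hS
    obtain ⟨r, hr, er⟩ := exists_u_mul k hp
    have hJ : xiOn F J ≤ xiOn F (insert k J) := xiOn_mono (Finset.subset_insert _ _)
    refine ⟨r * q * p', relIdeal_mul_mem (hJ hp') (mul_mem_relIdeal (hJ hr) hq), r * x * p',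
      Subalgebra.mul_mem _ (Subalgebra.mul_mem _ hr hx) hp', ?_⟩
    rw [← mul_assoc, ← mul_assoc, er, mul_assoc r, e, mul_add, add_mul]
  | zero => exact ⟨0, Submodule.zero_mem _, 0, Subalgebra.zero_mem _, by simp⟩
  | add f g _ _ hf hg =>
    obtain ⟨q, hq, x, hx, e⟩ := hf
    obtain ⟨q', hq', x', hx', e'⟩ := hg
    refine ⟨_, Submodule.add_mem _ hq hq', _, Subalgebra.add_mem _ hx hx', ?_⟩
    rw [mul_add, e, e']
    abel
  | smul r f _ hf =>
    obtain ⟨q, hq, x, hx, e⟩ := hf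
    exact ⟨_, Submodule.smul_mem _ r hq, _, Subalgebra.smul_mem _ hx r,
      by rw [mul_smul_comm, e, smul_add]⟩

end lift

/-! ### Filtration by the order in one pair of generators -/

/-- The span of the `t_k ^ e * x`, `e ≤ N`, and the `t_k ^ e * u_k * x`, `e < N`, where `x` is in the
subalgebra generated by the `t_i` and `u_i`, `i ∈ J`. -/
def orderLE (F : Type*) [Field F] {m : ℕ} (k : Fin m) (J : Finset (Fin m)) :
    ℕ → Submodule F (Xi F m)
  | 0 => Subalgebra.toSubmodule (xiOn F J)
  | N + 1 => orderLE F k J N ⊔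
      ((Subalgebra.toSubmodule (xiOn F J)).map (LinearMap.mulLeft F (tVar F k ^ (N + 1))) ⊔
        (Subalgebra.toSubmodule (xiOn F J)).map (LinearMap.mulLeft F (tVar F k ^ N * u F k)))

theorem mem_orderLE_succ {k : Fin m} {J : Finset (Fin m)} {N : ℕ} {f : Xi F m} :
    f ∈ orderLE F k J (N + 1) ↔ ∃ g ∈ orderLE F k J N, ∃ x ∈ xiOn F J, ∃ y ∈ xiOn F J,
      f = g + (tVar F k ^ (N + 1) * x + tVar F k ^ N * u F k * y) := by
  rw [orderLE, Submodule.mem_sup]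
  constructor
  · rintro ⟨g, hg, h, hh, rfl⟩
    obtain ⟨_, ⟨x, hx, rfl⟩, _, ⟨y, hy, rfl⟩, rfl⟩ := Submodule.mem_sup.1 hh
    exact ⟨g, hg, x, hx, y, hy, rfl⟩
  · rintro ⟨g, hg, x, hx, y, hy, rfl⟩
    exact ⟨g, hg, _, Submodule.add_mem_sup ⟨x, hx, rfl⟩ ⟨y, hy, rfl⟩, rfl⟩

theorem orderLE_mono (k : Fin m) (J : Finset (Fin m)) : Monotone (orderLE F k J) :=
  monotone_nat_of_le_succ fun _ => le_sup_left

theorem pow_mul_mem_orderLE (k : Fin m) {J : Finset (Fin m)} (N : ℕ) {x : Xi F m}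
    (hx : x ∈ xiOn F J) : tVar F k ^ N * x ∈ orderLE F k J N := by
  cases N with
  | zero => rw [pow_zero, one_mul]; exact hx
  | succ N =>
    exact mem_orderLE_succ.2 ⟨0, Submodule.zero_mem _, x, hx, 0, Subalgebra.zero_mem _, by simp⟩

theorem pow_mul_u_mul_mem_orderLE (k : Fin m) {J : Finset (Fin m)} (N : ℕ) {x : Xi F m}
    (hx : x ∈ xiOn F J) : tVar F k ^ N * u F k * x ∈ orderLE F k J (N + 1) :=
  mem_orderLE_succ.2 ⟨0, Submodule.zero_mem _, 0, Subalgebra.zero_mem _, x, hx, by simp⟩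

/-- Since `t_k` is central, `u_k` can be moved to the left and `u_k ^ 2 = 0`, the span of the
elements `t_k ^ N x` and `t_k ^ N u_k x` is closed under multiplication, and it contains all
generators. -/
theorem exists_mem_orderLE {k : Fin m} {J : Finset (Fin m)} {f : Xi F m}
    (hf : f ∈ xiOn F (insert k J)) : ∃ N, f ∈ orderLE F k J N := by
  set G : Set (Xi F m) := {f | ∃ N, ∃ x ∈ xiOn F J, f = tVar F k ^ N * x} ∪
    {f | ∃ N, ∃ x ∈ xiOn F J, f = tVar F k ^ N * u F k * x} with hG
  have hmulG : ∀ f ∈ G, ∀ g ∈ G, f * g ∈ Submodule.span F G := by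
    have hc : ∀ (N : ℕ) (x : Xi F m), x * tVar F k ^ N = tVar F k ^ N * x := fun N x =>
      ((tVar_commute k x).pow_left N).eq.symm
    rintro _ (⟨N, x, hx, rfl⟩ | ⟨N, x, hx, rfl⟩) _ (⟨M, y, hy, rfl⟩ | ⟨M, y, hy, rfl⟩)
    · refine Submodule.subset_span (Or.inl ⟨N + M, x * y, Subalgebra.mul_mem _ hx hy, ?_⟩)
      rw [pow_add, mul_assoc, ← mul_assoc x, hc]
      simp only [mul_assoc]
    · obtain ⟨z, hz, e⟩ := exists_mul_u k hx
      refine Submodule.subset_span (Or.inr ⟨N + M, z * y, Subalgebra.mul_mem _ hz hy, ?_⟩)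
      rw [pow_add, mul_assoc, ← mul_assoc x, ← mul_assoc x, hc, mul_assoc _ x, e]
      simp only [mul_assoc]
    · refine Submodule.subset_span (Or.inr ⟨N + M, x * y, Subalgebra.mul_mem _ hx hy, ?_⟩)
      rw [pow_add, mul_assoc, ← mul_assoc x, hc, mul_assoc _ x, mul_assoc _ (u F k),
        ← mul_assoc (u F k), hc]
      simp only [mul_assoc]
    · obtain ⟨z, hz, e⟩ := exists_mul_u k hx
      have : tVar F k ^ N * u F k * x * (tVar F k ^ M * u F k * y) = 0 := by
        calc _ = tVar F k ^ N * (u F k * (x * tVar F k ^ M)) * u F k * y := by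
              simp only [mul_assoc]
          _ = tVar F k ^ N * ((u F k * tVar F k ^ M) * (x * u F k)) * y := by
              rw [hc]; simp only [mul_assoc]
          _ = tVar F k ^ N * tVar F k ^ M * ((u F k * u F k) * (z * y)) := by
              rw [hc, e]; simp only [mul_assoc]
          _ = 0 := by rw [u_mul_self, zero_mul, mul_zero]
      rw [this]
      exact Submodule.zero_mem _
  have hmul : ∀ f g, f ∈ Submodule.span F G → g ∈ Submodule.span F G →
      f * g ∈ Submodule.span F G := by
    intro f g hf hg
    have h := Submodule.mul_mem_mul hf hg
    rw [Submodule.span_mul_span] at h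
    refine Submodule.span_le.2 ?_ h
    rintro _ ⟨f, hf, g, hg, rfl⟩
    exact hmulG f hf g hg
  have hone : (1 : Xi F m) ∈ Submodule.span F G :=
    Submodule.subset_span (Or.inl ⟨0, 1, Subalgebra.one_mem _, by simp⟩)
  have hle : xiOn F (insert k J) ≤ (Submodule.span F G).toSubalgebra hone hmul := by
    refine xiOn_le (fun i hi => ?_) fun i hi => ?_
    · rcases Finset.mem_insert.1 hi with rfl | hi
      · exact Submodule.subset_span (Or.inl ⟨1, 1, Subalgebra.one_mem _, by simp⟩)
      · exact Submodule.subset_span (Or.inl ⟨0, _, tVar_mem hi, by simp⟩)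
    · rcases Finset.mem_insert.1 hi with rfl | hi
      · exact Submodule.subset_span (Or.inr ⟨0, 1, Subalgebra.one_mem _, by simp⟩)
      · exact Submodule.subset_span (Or.inl ⟨0, _, u_mem hi, by simp⟩)
  have hf' : f ∈ Submodule.span F G := hle hf
  clear hf
  induction hf' using Submodule.span_induction with
  | mem f hf =>
    obtain ⟨N, x, hx, rfl⟩ | ⟨N, x, hx, rfl⟩ := hf
    · exact ⟨N, pow_mul_mem_orderLE k N hx⟩
    · exact ⟨N + 1, pow_mul_u_mul_mem_orderLE k N hx⟩
  | zero => exact ⟨0, Submodule.zero_mem _⟩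
  | add f g _ _ hf hg =>
    obtain ⟨N, hN⟩ := hf
    obtain ⟨M, hM⟩ := hg
    exact ⟨max N M, Submodule.add_mem _ (orderLE_mono k J (le_max_left _ _) hN)
      (orderLE_mono k J (le_max_right _ _) hM)⟩
  | smul r f _ hf =>
    obtain ⟨N, hN⟩ := hf
    exact ⟨N, Submodule.smul_mem _ _ hN⟩

end

/-! ### Evaluation in the field of rational functions -/

section

variable {F : Type*} [Field F] {n m : ℕ}

theorem map_evalXi {B B' : Type*} [CommRing B] [Algebra F B] [CommRing B'] [Algebra F B']
    (g : B →ₐ[F] B') (π : (Fin n → F) →ₗ[F] (Fin n → F)) {τ : Fin m → B} {τ' : Fin m → B'}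
    {c c' : Fin m → Fin n → F} {J : Finset (Fin m)} (hτ : ∀ i ∈ J, g (τ i) = τ' i)
    (hc : ∀ i ∈ J, π (c i) = c' i) {x : Xi F m} (hx : x ∈ xiOn F J) :
    Algebra.TensorProduct.map g (ExteriorAlgebra.map π) (evalXi τ c x) = evalXi τ' c' x := by
  refine xiOn_eqOn (f := (Algebra.TensorProduct.map g (ExteriorAlgebra.map π)).comp (evalXi τ c))
    (fun i hi => ?_) (fun i hi => ?_) hx
  · simp [hτ i hi]
  · simp [hτ i hi, hc i hi]

/-- The field `F(x_1, …, x_n)`. -/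
abbrev RatFun (F : Type*) [Field F] (n : ℕ) : Type _ :=
  FractionRing (MvPolynomial (Fin n) F)

/-- The reciprocal of the linear form `z_i` in `F(x_1, …, x_n)`. -/
def recip (c : Fin m → Fin n → F) (i : Fin m) : RatFun F n :=
  (algebraMap (MvPolynomial (Fin n) F) (RatFun F n) (linPoly F n (c i)))⁻¹

theorem algebraMap_linPoly_ne_zero {v : Fin n → F} (hv : v ≠ 0) :
    algebraMap (MvPolynomial (Fin n) F) (RatFun F n) (linPoly F n v) ≠ 0 := by
  rw [Ne, FaithfulSMul.algebraMap_eq_zero_iff, map_eq_zero_iff _ linPoly_injective]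
  exact hv

theorem evalXi_recip_relPolySuper {c : Fin m → Fin n → F} {a : Fin m → F}
    (hc : ∀ i ∈ supp a, c i ≠ 0) (ha : IsMinimalRelation c a) {S : Finset (Fin m)}
    (hS : S ⊆ supp a) : evalXi (recip c) c (relPolySuper a S) = 0 := by
  have h := (isRelation_iff.1 ha.1).2
  rw [← sum_supp] at h
  refine evalXi_relPolySuper (recip c) (fun i => algebraMap _ _ (linPoly F n (c i))) c
    (fun i hi => inv_mul_cancel₀ (algebraMap_linPoly_ne_zero (hc i hi))) ?_ h hS
  have e : ∑ i ∈ supp a, a i • algebraMap (MvPolynomial (Fin n) F) (RatFun F n)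
      (linPoly F n (c i)) = algebraMap (MvPolynomial (Fin n) F) (RatFun F n)
        (linPoly F n (∑ i ∈ supp a, a i • c i)) := by
    rw [map_sum, map_sum]
    refine Finset.sum_congr rfl fun i _ => ?_
    rw [map_smul]
    exact (map_smul (IsScalarTower.toAlgHom F (MvPolynomial (Fin n) F) (RatFun F n)) _ _).symm
  rw [e, h, map_zero, map_zero]

theorem evalXi_recip_relIdeal {c : Fin m → Fin n → F} {J : Finset (Fin m)}
    (hc : ∀ i ∈ J, c i ≠ 0) {f : Xi F m} (hf : f ∈ relIdeal c J) :
    evalXi (recip c) c f = 0 := by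
  induction hf using Submodule.span_induction with
  | mem f hf =>
    obtain ⟨a, S, x, y, ha, haJ, hS, _, _, rfl⟩ := hf
    rw [map_mul, map_mul, evalXi_recip_relPolySuper (fun i hi => hc i (haJ hi)) ha hS, mul_zero,
      zero_mul]
  | zero => exact map_zero _
  | add f g _ _ hf hg => rw [map_add, hf, hg, add_zero]
  | smul r f _ hf => rw [map_smul, hf, smul_zero]

theorem map_injective_of_left {B B' : Type*} [CommRing B] [Algebra F B] [CommRing B']
    [Algebra F B'] {g : B →ₐ[F] B'} (hg : Function.Injective g) (E : Type*) [Ring E]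
    [Algebra F E] : Function.Injective (Algebra.TensorProduct.map g (AlgHom.id F E)) :=
  Module.Flat.rTensor_preserves_injective_linearMap (M := E) g.toLinearMap hg

/-- An element annihilated by the linear form `v` vanishes modulo `v`. -/
theorem map_eq_zero_of_ι_mul_eq_zero {B : Type*} [CommRing B] [Algebra F B] {v : Fin n → F}
    {φ : Module.Dual F (Fin n → F)} (hφ : φ v = 1) {π : (Fin n → F) →ₗ[F] (Fin n → F)}
    (hπ : π v = 0) {w : B ⊗[F] ExteriorAlgebra F (Fin n → F)}
    (hw : (1 ⊗ₜ ExteriorAlgebra.ι F v) * w = 0) :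
    Algebra.TensorProduct.map (AlgHom.id F B) (ExteriorAlgebra.map π) w = 0 := by
  set d : B ⊗[F] ExteriorAlgebra F (Fin n → F) →ₗ[F] B ⊗[F] ExteriorAlgebra F (Fin n → F) :=
    LinearMap.lTensor B (CliffordAlgebra.contractLeft (Q := (0 : QuadraticForm F (Fin n → F))) φ)
    with hd
  -- Contraction with `φ` is an antiderivation taking `v` to `1`. So `v w = 0` gives `w = v · d w`,
  -- and `π` kills the factor `v`.
  have key : ∀ w : B ⊗[F] ExteriorAlgebra F (Fin n → F),
      d ((1 ⊗ₜ ExteriorAlgebra.ι F v) * w) = w - (1 ⊗ₜ ExteriorAlgebra.ι F v) * d w := by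
    intro w
    induction w using TensorProduct.induction_on with
    | zero => simp
    | tmul b q =>
      rw [Algebra.TensorProduct.tmul_mul_tmul, one_mul, hd, LinearMap.lTensor_tmul,
        LinearMap.lTensor_tmul, Algebra.TensorProduct.tmul_mul_tmul, one_mul,
        ← TensorProduct.tmul_sub]
      congr 1
      have := CliffordAlgebra.contractLeft_ι_mul (Q := (0 : QuadraticForm F (Fin n → F))) φ v q
      rw [hφ, one_smul] at this
      exact this
    | add x y hx hy => rw [mul_add, map_add, hx, hy, map_add, mul_add]; abel
  have h := key w
  rw [hw, map_zero] at h
  have e := congrArg (Algebra.TensorProduct.map (AlgHom.id F B) (ExteriorAlgebra.map π))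
    (sub_eq_zero.1 h.symm)
  rw [e, map_mul, Algebra.TensorProduct.map_tmul,
    ExteriorAlgebra.map_apply_ι, hπ, map_zero, TensorProduct.tmul_zero, zero_mul]

/-! ### The leading terms of an element of the kernel -/

section leading

variable {c : Fin m → Fin n → F} {k : Fin m} {J : Finset (Fin m)} {D : Type*} [CommRing D]
  [Algebra F D] {g : D →ₐ[F] RatFun F n} {τ : Fin m → D} {z : D}

/-- The ring `D` stands for functions in which `z = z_k` is not necessarily invertible, so that `z =
0` can be imposed later. As `u_k ↦ z_k⁻¹ dz_k` itself has a simple pole, `t_k ^ N u_k` has order `N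
+ 1`, like `t_k ^ (N + 1)`; after clearing, these two become `dz_k` and `1`. -/
theorem exists_clear_denominator_succ (hk : c k ≠ 0) (hτ : ∀ i ∈ J, g (τ i) = recip c i)
    (hz : g z = algebraMap _ _ (linPoly F n (c k))) {N : ℕ} {f x y : Xi F m}
    {w : D ⊗[F] ExteriorAlgebra F (Fin n → F)}
    (hw : Algebra.TensorProduct.map g (AlgHom.id F _) w =
      (g z ^ N) ⊗ₜ 1 * evalXi (recip c) c f) (hx : x ∈ xiOn F J) (hy : y ∈ xiOn F J) :
    Algebra.TensorProduct.map g (AlgHom.id F _) ((z ⊗ₜ 1) * w + (evalXi τ c x +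
        (1 ⊗ₜ ExteriorAlgebra.ι F (c k)) * evalXi τ c y)) =
      (g z ^ (N + 1)) ⊗ₜ 1 * evalXi (recip c) c
        (f + (tVar F k ^ (N + 1) * x + tVar F k ^ N * u F k * y)) := by
  have hz0 : g z ≠ 0 := hz ▸ algebraMap_linPoly_ne_zero hk
  have hr : recip c k = (g z)⁻¹ := by rw [recip, hz]
  have hm : ∀ {x : Xi F m}, x ∈ xiOn F J →
      Algebra.TensorProduct.map g (AlgHom.id F _) (evalXi τ c x) = evalXi (recip c) c x := by
    intro x hx
    rw [← ExteriorAlgebra.map_id]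
    exact map_evalXi g LinearMap.id hτ (fun _ _ => rfl) hx
  have e1 : (g z ^ (N + 1)) ⊗ₜ[F] (1 : ExteriorAlgebra F (Fin n → F)) *
      evalXi (recip c) c (tVar F k ^ (N + 1)) = 1 := by
    rw [map_pow, evalXi_tVar, Algebra.TensorProduct.tmul_pow, one_pow,
      Algebra.TensorProduct.tmul_mul_tmul, one_mul, ← mul_pow, hr, mul_inv_cancel₀ hz0, one_pow,
      Algebra.TensorProduct.one_def]
  have e2 : (g z ^ (N + 1)) ⊗ₜ[F] (1 : ExteriorAlgebra F (Fin n → F)) *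
      evalXi (recip c) c (tVar F k ^ N * u F k) = 1 ⊗ₜ ExteriorAlgebra.ι F (c k) := by
    rw [map_mul, map_pow, evalXi_tVar, evalXi_u, Algebra.TensorProduct.tmul_pow, one_pow,
      Algebra.TensorProduct.tmul_mul_tmul, Algebra.TensorProduct.tmul_mul_tmul, one_mul, one_mul,
      ← pow_succ, ← mul_pow, hr, mul_inv_cancel₀ hz0, one_pow]
  rw [map_add, map_add, map_mul, map_mul, hw, hm hx, hm hy, map_add, map_add, mul_add, mul_add,
    map_mul _ (tVar F k ^ (N + 1)) x, map_mul _ (tVar F k ^ N * u F k) y, ← mul_assoc _ _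
      (evalXi (recip c) c x), ← mul_assoc _ _ (evalXi (recip c) c y), e1, e2, one_mul,
    Algebra.TensorProduct.map_tmul, Algebra.TensorProduct.map_tmul, map_one, map_one,
    ← mul_assoc, Algebra.TensorProduct.tmul_mul_tmul, one_mul, pow_succ', AlgHom.id_apply]

theorem exists_clear_denominator (hk : c k ≠ 0) (hτ : ∀ i ∈ J, g (τ i) = recip c i)
    (hz : g z = algebraMap _ _ (linPoly F n (c k))) {N : ℕ} {f : Xi F m}
    (hf : f ∈ orderLE F k J N) : ∃ w : D ⊗[F] ExteriorAlgebra F (Fin n → F),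
      Algebra.TensorProduct.map g (AlgHom.id F _) w = (g z ^ N) ⊗ₜ 1 * evalXi (recip c) c f := by
  induction N generalizing f with
  | zero =>
    refine ⟨evalXi τ c f, ?_⟩
    rw [pow_zero, ← Algebra.TensorProduct.one_def, one_mul, ← ExteriorAlgebra.map_id]
    exact map_evalXi g LinearMap.id hτ (fun _ _ => rfl) hf
  | succ N ih =>
    obtain ⟨f', hf', x, hx, y, hy, rfl⟩ := mem_orderLE_succ.1 hf
    obtain ⟨w, hw⟩ := ih hf'
    exact ⟨_, exists_clear_denominator_succ hk hτ hz hw hx hy⟩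

/-- The identity holds over `F(x_1, …, x_n)` by clearing denominators, and descends to `D` by
injectivity; only over `D` can it be reduced modulo `z`. -/
theorem exists_leading_eq_zero (hg : Function.Injective g) (hk : c k ≠ 0)
    (hτ : ∀ i ∈ J, g (τ i) = recip c i) (hz : g z = algebraMap _ _ (linPoly F n (c k))) {N : ℕ}
    {f x y : Xi F m} (hf : f ∈ orderLE F k J N) (hx : x ∈ xiOn F J) (hy : y ∈ xiOn F J)
    (h0 : evalXi (recip c) c (f + (tVar F k ^ (N + 1) * x + tVar F k ^ N * u F k * y)) = 0) :
    ∃ w : D ⊗[F] ExteriorAlgebra F (Fin n → F), (z ⊗ₜ 1) * w + (evalXi τ c x +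
        (1 ⊗ₜ ExteriorAlgebra.ι F (c k)) * evalXi τ c y) = 0 := by
  obtain ⟨w, hw⟩ := exists_clear_denominator hk hτ hz hf
  refine ⟨w, map_injective_of_left hg _ ?_⟩
  rw [exists_clear_denominator_succ hk hτ hz hw hx hy, h0, mul_zero, map_zero]

end leading

/-! ### Restriction to a hyperplane -/

/-- The ring `F[x_1, …, x_n]` with the `z_i`, `i ∈ J`, inverted. -/
abbrev ROn (c : Fin m → Fin n → F) (J : Finset (Fin m)) : Type _ :=
  Localization (Submonoid.closure ((fun i => linPoly F n (c i)) '' J))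

open Classical in
/-- The element `z_i⁻¹` for `i ∈ J`. -/
def recipOn (c : Fin m → Fin n → F) (J : Finset (Fin m)) (i : Fin m) : ROn c J :=
  if hi : i ∈ J then
    Localization.mk 1 ⟨linPoly F n (c i), Submonoid.subset_closure ⟨i, hi, rfl⟩⟩ else 0

theorem algebraMap_mul_recipOn (c : Fin m → Fin n → F) {J : Finset (Fin m)} {i : Fin m}
    (hi : i ∈ J) : algebraMap _ (ROn c J) (linPoly F n (c i)) * recipOn c J i = 1 := by
  rw [recipOn, dif_pos hi, ← Localization.mk_one_eq_algebraMap, Localization.mk_mul,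
    ← Localization.mk_one, Localization.mk_eq_mk_iff, Localization.r_iff_exists]
  exact ⟨1, by simp⟩

/-- The endomorphism of `F[x_1, …, x_n]` that extends an endomorphism of the linear forms. -/
def polyMap (π : (Fin n → F) →ₗ[F] (Fin n → F)) :
    MvPolynomial (Fin n) F →ₐ[F] MvPolynomial (Fin n) F :=
  MvPolynomial.aeval fun j => linPoly F n (π (Pi.single j 1))

theorem polyMap_linPoly (π : (Fin n → F) →ₗ[F] (Fin n → F)) (v : Fin n → F) :
    polyMap π (linPoly F n v) = linPoly F n (π v) := by
  have : (polyMap π).toLinearMap ∘ₗ linPoly F n = linPoly F n ∘ₗ π := by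
    refine LinearMap.pi_ext' fun j => LinearMap.ext_ring ?_
    simp [polyMap, linPoly, Fintype.linearCombination_apply_single]
  exact LinearMap.congr_fun this v

/-- The substitution extends to the localization because each inverted form goes to a non-zero form.
For a projection along `c k` with `k ∉ J`, this is restriction to `z_k = 0`. -/
theorem exists_restriction (c : Fin m → Fin n → F) (J : Finset (Fin m))
    (π : (Fin n → F) →ₗ[F] (Fin n → F)) (hπ : ∀ i ∈ J, π (c i) ≠ 0) :
    ∃ g : ROn c J →ₐ[F] RatFun F n,
      (∀ i ∈ J, g (recipOn c J i) = recip (fun i => π (c i)) i) ∧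
      ∀ v, g (algebraMap _ _ (linPoly F n v)) = algebraMap _ _ (linPoly F n (π v)) := by
  set f : MvPolynomial (Fin n) F →ₐ[F] RatFun F n :=
    (IsScalarTower.toAlgHom F (MvPolynomial (Fin n) F) (RatFun F n)).comp (polyMap π) with hf
  have hfv : ∀ v, f (linPoly F n v) = algebraMap _ _ (linPoly F n (π v)) := by
    intro v
    rw [hf, AlgHom.comp_apply, polyMap_linPoly, IsScalarTower.coe_toAlgHom']
  have hu : ∀ y : Submonoid.closure ((fun i => linPoly F n (c i)) '' J), IsUnit (f y) := by
    have : Submonoid.closure ((fun i => linPoly F n (c i)) '' J) ≤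
        (IsUnit.submonoid (RatFun F n)).comap f := by
      rw [Submonoid.closure_le]
      rintro _ ⟨i, hi, rfl⟩
      change IsUnit (f (linPoly F n (c i)))
      rw [hfv]
      exact (algebraMap_linPoly_ne_zero (hπ i hi)).isUnit
    exact fun y => this y.2
  have hv : ∀ v, IsLocalization.liftAlgHom (S := ROn c J) hu (algebraMap _ _ (linPoly F n v)) =
      algebraMap _ _ (linPoly F n (π v)) := by
    intro v
    rw [← hfv, IsLocalization.liftAlgHom_apply]
    exact IsLocalization.lift_eq _ _
  refine ⟨IsLocalization.liftAlgHom hu, fun i hi => ?_, hv⟩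
  refine eq_inv_of_mul_eq_one_right ?_
  rw [← hv, ← map_mul, algebraMap_mul_recipOn c hi, map_one]

theorem exists_localization_embedding {M : Submonoid (MvPolynomial (Fin n) F)}
    (hM : M ≤ nonZeroDivisors _) :
    ∃ g : Localization M →ₐ[F] RatFun F n, Function.Injective g ∧
      ∀ p, g (algebraMap (MvPolynomial (Fin n) F) (Localization M) p) = algebraMap _ _ p := by
  have hu : ∀ y : M, IsUnit (IsScalarTower.toAlgHom F (MvPolynomial (Fin n) F) (RatFun F n) y) :=
    fun y => IsLocalization.map_units (RatFun F n) ⟨y.1, hM y.2⟩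
  refine ⟨IsLocalization.liftAlgHom hu, ?_, fun p => ?_⟩
  · rw [IsLocalization.coe_liftAlgHom]
    refine (IsLocalization.lift_injective_iff _).2 fun x y => ?_
    rw [(IsLocalization.injective (Localization M) hM).eq_iff]
    exact (IsFractionRing.injective (MvPolynomial (Fin n) F) (RatFun F n)).eq_iff.symm
  · rw [IsLocalization.liftAlgHom_apply]
    exact IsLocalization.lift_eq _ _

theorem exists_inclusion (c : Fin m → Fin n → F) {J : Finset (Fin m)} (hc : ∀ i ∈ J, c i ≠ 0) :
    ∃ g : ROn c J →ₐ[F] RatFun F n, Function.Injective g ∧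
      (∀ i ∈ J, g (recipOn c J i) = recip c i) ∧
      ∀ v, g (algebraMap _ _ (linPoly F n v)) = algebraMap _ _ (linPoly F n v) := by
  obtain ⟨g, hg, hgp⟩ := exists_localization_embedding
    (M := Submonoid.closure ((fun i => linPoly F n (c i)) '' J)) (by
      rw [Submonoid.closure_le]
      rintro _ ⟨i, hi, rfl⟩
      refine mem_nonZeroDivisors_of_ne_zero fun h => hc i hi ?_
      exact (map_eq_zero_iff _ linPoly_injective).1 h)
  refine ⟨g, hg, fun i hi => eq_inv_of_mul_eq_one_right ?_, fun v => hgp _⟩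
  rw [← hgp, ← map_mul, algebraMap_mul_recipOn c hi, map_one]

end

/-! ### The kernels -/

section

variable {F : Type*} [Field F] {n m : ℕ}

/-- The homomorphism `A ⊗ Λ V → A` that kills `V`. -/
def augment (A : Type*) [CommRing A] [Algebra F A] (V : Type*) [AddCommGroup V] [Module F V] :
    A ⊗[F] ExteriorAlgebra F V →ₐ[F] A :=
  Algebra.TensorProduct.lift (AlgHom.id F A)
    ((Algebra.ofId F A).comp ExteriorAlgebra.algebraMapInv) fun _ _ => Commute.all _ _

theorem augment_left {A : Type*} [CommRing A] [Algebra F A] (V : Type*) [AddCommGroup V]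
    [Module F V] (p : A) : augment A V (p ⊗ₜ[F] 1) = p := by
  simp [augment]

/-- Every ordered product over a non-empty `S` contains some `u_i`, which the augmentation kills. -/
theorem augment_relPolySuper {a : Fin m → F} {S : Finset (Fin m)} (hS : S.Nonempty) :
    augment (MvPolynomial (Fin m) F) (Fin m → F) (relPolySuper a S) = 0 := by
  have hu : ∀ i, augment (MvPolynomial (Fin m) F) (Fin m → F) (u F i) = 0 := by
    intro i
    simp [augment, u, ExteriorAlgebra.algebraMapInv]
  have hz : ∀ g : Fin m → Xi F m, (∀ i, augment (MvPolynomial (Fin m) F) (Fin m → F) (g i) = 0) →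
      augment (MvPolynomial (Fin m) F) (Fin m → F) (oprod S g) = 0 := by
    intro g hg
    obtain ⟨i, hi⟩ := hS
    rw [map_oprod, oprod]
    exact List.prod_eq_zero (List.mem_map.2 ⟨i, (Finset.mem_sort _).2 hi, hg i⟩)
  rw [relPolySuper, map_sum]
  refine Finset.sum_eq_zero fun i _ => ?_
  rw [map_mul, map_sub, map_sum, hz _ hu, Finset.sum_eq_zero fun j _ => hz _ fun l => ?_, sub_zero,
    mul_zero]
  by_cases hl : l = j
  · rw [hl, Function.update_self, hu]
  · rw [Function.update_of_ne hl, hu]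

/-! ### The induction step. -/

/-- For the relation `z_j - b z_k`, the generators with `S = ∅` and `S = {j}` are `t_k - b t_j` and
`b (u_k - u_j)`. Modulo them `f` has a representative free of `t_k, u_k`, which is again in the
kernel. -/
theorem mem_relIdeal_insert_of_parallel {c : Fin m → Fin n → F} {J : Finset (Fin m)} {k : Fin m}
    (hkJ : k ∉ J) (hc : ∀ i ∈ insert k J, c i ≠ 0)
    (ih : ∀ f ∈ xiOn F J, evalXi (recip c) c f = 0 → f ∈ relIdeal c J)
    {j : Fin m} (hj : j ∈ J) {b : F} (hb : c j = b • c k) {f : Xi F m}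
    (hf : f ∈ xiOn F (insert k J)) (h0 : evalXi (recip c) c f = 0) :
    f ∈ relIdeal c (insert k J) := by
  have hjk : j ≠ k := fun h => hkJ (h ▸ hj)
  have hj' : j ∈ insert k J := Finset.mem_insert_of_mem hj
  have hk' : k ∈ insert k J := Finset.mem_insert_self k J
  have hb0 : b ≠ 0 := by
    rintro rfl
    exact hc j hj' (by rw [hb, zero_smul])
  have hmin := isMinimalRelation_of_parallel hjk (hc j hj') (hc k hk') hb
  set a : Fin m → F := Pi.single j 1 - Pi.single k b with ha
  have haj : a j = 1 := by simp [ha, hjk]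
  have hak : a k = -b := by simp [ha, hjk.symm]
  have hsupp : supp a = {j, k} := by
    ext i
    rw [mem_supp, Finset.mem_insert, Finset.mem_singleton]
    by_cases hij : i = j
    · simp [hij, haj]
    · by_cases hik : i = k
      · simp [hik, hak, hb0]
      · simp [ha, hij, hik]
  have hsJ : supp a ⊆ insert k J := by
    rw [hsupp]
    intro i hi
    rcases Finset.mem_insert.1 hi with rfl | hi
    · exact hj'
    · rwa [Finset.mem_singleton.1 hi]
  have ht : tVar F k - b • tVar F j ∈ relIdeal c (insert k J) := by
    have h := relPolySuper_mem_relIdeal hmin hsJ (Finset.empty_subset _)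
    have e : relPoly a = MvPolynomial.X k - b • MvPolynomial.X j := by
      rw [relPoly, hsupp, Finset.sum_pair hjk, haj, hak,
        Finset.erase_insert (by simpa using hjk), Finset.pair_comm j k,
        Finset.erase_insert (by simpa using hjk.symm), Finset.prod_singleton,
        Finset.prod_singleton, map_one, one_mul, map_neg, neg_mul, ← sub_eq_add_neg,
        MvPolynomial.smul_eq_C_mul]
    rw [relPolySuper_empty, e, TensorProduct.sub_tmul] at h
    exact h
  have hu : u F k - u F j ∈ relIdeal c (insert k J) := by
    have hS : ({j} : Finset (Fin m)) ⊆ supp a := by rw [hsupp]; simp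
    have h := Submodule.smul_mem _ b⁻¹ (relPolySuper_mem_relIdeal hmin hsJ hS)
    have e : relPolySuper a {j} = b • (u F k - u F j) := by
      have e1 : supp a \ {j} = {k} := by
        rw [hsupp]
        ext i
        simp only [Finset.mem_sdiff, Finset.mem_insert, Finset.mem_singleton]
        grind
      have e2 : supp a \ {k, j} = ∅ := by
        rw [hsupp, Finset.pair_comm, Finset.sdiff_self]
      have e3 : ∀ g : Fin m → Xi F m, oprod {j} g = g j := fun g => by simp [oprod]
      have e4 : ((MvPolynomial.C (-b) * 1) ⊗ₜ 1 : Xi F m) = algebraMap F (Xi F m) (-b) := by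
        rw [mul_one, Algebra.TensorProduct.algebraMap_apply, MvPolynomial.algebraMap_eq]
      rw [relPolySuper, e1, Finset.sum_singleton, e2, Finset.prod_empty, hak, Finset.sum_singleton,
        e3, e3, Function.update_self, e4, ← Algebra.smul_def]
      exact (neg_smul b (u F j - u F k)).trans
        ((smul_neg b (u F j - u F k)).symm.trans (congrArg (b • ·) (neg_sub _ _)))
    rwa [e, smul_smul, inv_mul_cancel₀ hb0, one_smul] at h
  have hJ : xiOn F J ≤ xiOn F (insert k J) := xiOn_mono (Finset.subset_insert _ _)
  have key : ∃ g ∈ xiOn F J, f - g ∈ relIdeal c (insert k J) := by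
    clear h0
    induction hf using Algebra.adjoin_induction with
    | mem x hx =>
      obtain ⟨i, hi, rfl⟩ | ⟨i, hi, rfl⟩ := hx
      · rcases Finset.mem_insert.1 hi with rfl | hi
        · exact ⟨_, Subalgebra.smul_mem _ (tVar_mem hj) b, ht⟩
        · exact ⟨_, tVar_mem hi, by rw [sub_self]; exact Submodule.zero_mem _⟩
      · rcases Finset.mem_insert.1 hi with rfl | hi
        · exact ⟨_, u_mem hj, hu⟩
        · exact ⟨_, u_mem hi, by rw [sub_self]; exact Submodule.zero_mem _⟩
    | algebraMap r =>
      exact ⟨_, Subalgebra.algebraMap_mem _ r, by rw [sub_self]; exact Submodule.zero_mem _⟩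
    | add x y _ _ hx hy =>
      obtain ⟨x', hx', hxx⟩ := hx
      obtain ⟨y', hy', hyy⟩ := hy
      refine ⟨_, Subalgebra.add_mem _ hx' hy', ?_⟩
      rw [add_sub_add_comm]
      exact Submodule.add_mem _ hxx hyy
    | mul x y hxm _ hx hy =>
      obtain ⟨x', hx', hxx⟩ := hx
      obtain ⟨y', hy', hyy⟩ := hy
      refine ⟨_, Subalgebra.mul_mem _ hx' hy', ?_⟩
      have e : x * y - x' * y' = x * (y - y') + (x - x') * y' := by
        rw [mul_sub, sub_mul]; abel
      rw [e]
      exact Submodule.add_mem _ (mul_mem_relIdeal hxm hyy) (relIdeal_mul_mem (hJ hy') hxx)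
  obtain ⟨g, hg, hfg⟩ := key
  have h1 := evalXi_recip_relIdeal hc hfg
  rw [map_sub, h0, zero_sub, neg_eq_zero] at h1
  have h2 := Submodule.add_mem _ hfg (relIdeal_mono c (Finset.subset_insert _ _) (ih g hg h1))
  rwa [sub_add_cancel] at h2

theorem mem_relIdeal_insert_of_not_parallel {c : Fin m → Fin n → F} {J : Finset (Fin m)}
    {k : Fin m} (hkJ : ∀ i ∈ J, k < i) (hc : ∀ i ∈ insert k J, c i ≠ 0)
    (ih : ∀ c : Fin m → Fin n → F, (∀ i ∈ J, c i ≠ 0) →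
      ∀ f ∈ xiOn F J, evalXi (recip c) c f = 0 → f ∈ relIdeal c J)
    (hpar : ∀ j ∈ J, ∀ b : F, c j ≠ b • c k) {N : ℕ} {f : Xi F m} (hf : f ∈ orderLE F k J N)
    (h0 : evalXi (recip c) c f = 0) : f ∈ relIdeal c (insert k J) := by
  have hk : k ∉ J := fun h => lt_irrefl _ (hkJ k h)
  have hcJ : ∀ i ∈ J, c i ≠ 0 := fun i hi => hc i (Finset.mem_insert_of_mem hi)
  have hck : c k ≠ 0 := hc k (Finset.mem_insert_self k J)
  have hkk : k ∈ insert k J := Finset.mem_insert_self k J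
  obtain ⟨φ, hφ⟩ := Module.Projective.exists_dual_eq_one F hck
  -- The projection along `c k` models restriction to `z_k = 0`. The restricted forms are again
  -- vectors in `Fin n → F`, so the induction hypothesis applies with the same `n`.
  set π : (Fin n → F) →ₗ[F] (Fin n → F) := LinearMap.id - φ.smulRight (c k) with hπdef
  have hπv : ∀ v, π v = v - φ v • c k := fun v => rfl
  have hπ : ∀ v, π v = 0 ↔ ∃ r : F, v = r • c k := by
    intro v
    constructor
    · intro h
      exact ⟨φ v, by rwa [hπv, sub_eq_zero] at h⟩
    · rintro ⟨r, rfl⟩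
      rw [hπv, map_smul, hφ, smul_eq_mul, mul_one, sub_self]
  have hπk : π (c k) = 0 := (hπ _).2 ⟨1, (one_smul _ _).symm⟩
  have hπJ : ∀ i ∈ J, π (c i) ≠ 0 := by
    intro i hi h
    obtain ⟨r, hr⟩ := (hπ _).1 h
    exact hpar i hi r hr
  obtain ⟨g, hg, hgτ, hgz⟩ := exists_inclusion c hcJ
  obtain ⟨g', hgτ', hgz'⟩ := exists_restriction c J π hπJ
  have hgk : g' (algebraMap _ _ (linPoly F n (c k))) = 0 := by
    rw [hgz', hπk, map_zero, map_zero]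
  induction N generalizing f with
  | zero => exact relIdeal_mono c (Finset.subset_insert _ _) (ih c hcJ f hf h0)
  | succ N ihN =>
    obtain ⟨f', hf', x, hx, y, hy, rfl⟩ := mem_orderLE_succ.1 hf
    -- the coefficient of `t_k ^ (N + 1)` is in the kernel for the restricted arrangement
    have hx0 : evalXi (recip fun i => π (c i)) (fun i => π (c i)) x = 0 := by
      obtain ⟨w, hw⟩ := exists_leading_eq_zero hg hck hgτ (hgz (c k)) hf' hx hy h0
      -- Both `z_k` and `dz_k` are set to zero here, which leaves only `x`.
      have h1 := congrArg (Algebra.TensorProduct.map g' (ExteriorAlgebra.map π)) hw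
      rw [map_add, map_add, map_mul, map_mul, Algebra.TensorProduct.map_tmul,
        Algebra.TensorProduct.map_tmul, hgk, ExteriorAlgebra.map_apply_ι, hπk, map_zero,
        TensorProduct.zero_tmul, TensorProduct.tmul_zero, zero_mul, zero_mul, zero_add, add_zero,
        map_zero, map_evalXi g' π hgτ' (fun _ _ => rfl) hx] at h1
      exact h1
    obtain ⟨q, hq, x₁, hx₁, y₁, hy₁, e₁⟩ :=
      exists_tVar_mul_relIdeal hck hπ hk (ih _ hπJ x hx hx0)
    -- The part of order at most `N`; outside the ideal, `t_k ^ N u_k (y + y₁)` is now the only term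
    -- of top order.
    set f₁ : Xi F m := f' + tVar F k ^ N * x₁ with hf₁
    have hf₁m : f₁ ∈ orderLE F k J N :=
      Submodule.add_mem _ hf' (pow_mul_mem_orderLE k N hx₁)
    have hym : y + y₁ ∈ xiOn F J := Subalgebra.add_mem _ hy hy₁
    have hqm : tVar F k ^ N * q ∈ relIdeal c (insert k J) :=
      mul_mem_relIdeal (Subalgebra.pow_mem _ (tVar_mem hkk) _) hq
    have e₂ : f' + (tVar F k ^ (N + 1) * x + tVar F k ^ N * u F k * y) =
        tVar F k ^ N * q + (f₁ + tVar F k ^ N * u F k * (y + y₁)) := by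
      rw [pow_succ, mul_assoc _ (tVar F k) x, e₁, hf₁]
      simp only [mul_add, mul_assoc]
      abel
    rw [e₂, map_add, evalXi_recip_relIdeal hc hqm, zero_add] at h0
    rw [e₂]
    refine Submodule.add_mem _ hqm ?_
    -- the coefficient of `t_k ^ N * u_k` is in the kernel for the restricted arrangement
    have hy0 : evalXi (recip fun i => π (c i)) (fun i => π (c i)) (y + y₁) = 0 := by
      have h0' : evalXi (recip c) c
          (f₁ + (tVar F k ^ (N + 1) * 0 + tVar F k ^ N * u F k * (y + y₁))) = 0 := by
        rw [mul_zero, zero_add, h0]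
      obtain ⟨w, hw⟩ := exists_leading_eq_zero hg hck hgτ (hgz (c k)) hf₁m
        (Subalgebra.zero_mem _) hym h0'
      -- This time `z_k` is set to zero but `dz_k` is kept, leaving `dz_k (y + y₁) = 0`.
      have h1 := congrArg (Algebra.TensorProduct.map g' (AlgHom.id F _)) hw
      rw [map_add, map_add, map_mul, map_mul, Algebra.TensorProduct.map_tmul,
        Algebra.TensorProduct.map_tmul, hgk, TensorProduct.zero_tmul, zero_mul, zero_add,
        map_zero, map_zero, zero_add, map_one, AlgHom.id_apply] at h1
      have h2 := map_eq_zero_of_ι_mul_eq_zero hφ hπk h1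
      rw [← AlgHom.comp_apply, ← Algebra.TensorProduct.map_comp, AlgHom.id_comp,
        AlgHom.comp_id, map_evalXi g' π hgτ' (fun _ _ => rfl) hym] at h2
      exact h2
    obtain ⟨q', hq', x₂, hx₂, e₃⟩ := exists_u_mul_relIdeal hck hπ hkJ (ih _ hπJ _ hym hy0)
    have hqm' : tVar F k ^ N * q' ∈ relIdeal c (insert k J) :=
      mul_mem_relIdeal (Subalgebra.pow_mem _ (tVar_mem hkk) _) hq'
    have e₄ : f₁ + tVar F k ^ N * u F k * (y + y₁) =
        tVar F k ^ N * q' + (f₁ + tVar F k ^ N * x₂) := by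
      rw [mul_assoc, e₃, mul_add]
      abel
    rw [e₄, map_add, evalXi_recip_relIdeal hc hqm', zero_add] at h0
    rw [e₄]
    exact Submodule.add_mem _ hqm'
      (ihN (Submodule.add_mem _ hf₁m (pow_mul_mem_orderLE k N hx₂)) h0)

/-- The kernel of the evaluation of `Ξ` in `F(x_1, …, x_n) ⊗ Λ[dx_1, …, dx_n]` is generated by the
`P_{L,S}`. -/
theorem mem_relIdeal_of_evalXi_eq_zero (J : Finset (Fin m)) :
    ∀ c : Fin m → Fin n → F, (∀ i ∈ J, c i ≠ 0) →
      ∀ f ∈ xiOn F J, evalXi (recip c) c f = 0 → f ∈ relIdeal c J := by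
  -- The new index is the smallest one, so that `u_k` comes first in ordered products. The
  -- configuration `c` stays universally quantified because the step uses the hypothesis for `c` and
  -- for its projection.
  induction J using Finset.induction_on_min with
  | empty =>
    intro c _ f hf h0
    rw [xiOn, Finset.coe_empty, Set.image_empty, Set.image_empty, Set.union_empty,
      Algebra.adjoin_empty] at hf
    obtain ⟨r, rfl⟩ := Algebra.mem_bot.1 hf
    rw [AlgHom.commutes] at h0
    have h1 := congrArg (augment (RatFun F n) (Fin n → F)) h0
    rw [AlgHom.commutes, map_zero, map_eq_zero] at h1
    rw [h1, map_zero]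
    exact Submodule.zero_mem _
  | insert k J hkJ ih =>
    intro c hc f hf h0
    by_cases hpar : ∃ j ∈ J, ∃ b : F, c j = b • c k
    · obtain ⟨j, hj, b, hb⟩ := hpar
      exact mem_relIdeal_insert_of_parallel (fun h => lt_irrefl _ (hkJ k h)) hc
        (ih c fun i hi => hc i (Finset.mem_insert_of_mem hi)) hj hb hf h0
    · push Not at hpar
      obtain ⟨N, hN⟩ := exists_mem_orderLE hf
      exact mem_relIdeal_insert_of_not_parallel hkJ hc ih hpar hN h0

/-! ### From `F(x_1, …, x_n)` back to `R` and `T`. -/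

/-- The ring `R` embeds in `F(x_1, …, x_n)`, and the embedding survives tensoring with the exterior
algebra by flatness over `F`. -/
theorem psi_eq_zero_iff {c : Fin m → Fin n → F} (hc : ∀ i, c i ≠ 0) (f : Xi F m) :
    psi c f = 0 ↔ evalXi (recip c) c f = 0 := by
  obtain ⟨g, hg, hgp⟩ := exists_localization_embedding (M := zMonoid c) (by
    rw [zMonoid, Submonoid.closure_le]
    rintro _ ⟨i, rfl⟩
    refine mem_nonZeroDivisors_of_ne_zero fun h => hc i ?_
    rw [linForm_eq] at h
    exact (map_eq_zero_iff _ linPoly_injective).1 h)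
  have hz : ∀ i, g (zInv c i) = recip c i := by
    intro i
    refine eq_inv_of_mul_eq_one_right ?_
    rw [← hgp, ← map_mul, ← linForm_eq, zInv, ← Localization.mk_one_eq_algebraMap,
      Localization.mk_mul]
    refine (congrArg g ?_).trans (map_one g)
    rw [← Localization.mk_one, Localization.mk_eq_mk_iff, Localization.r_iff_exists]
    exact ⟨1, by simp⟩
  have e : Algebra.TensorProduct.map g (AlgHom.id F (ExteriorAlgebra F (Fin n → F))) (psi c f) =
      evalXi (recip c) c f := by
    refine xiOn_eqOn (J := Finset.univ) (f := (Algebra.TensorProduct.map g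
      (AlgHom.id F (ExteriorAlgebra F (Fin n → F)))).comp (psi c)) (fun i _ => ?_) (fun i _ => ?_)
      (xiOn_univ (F := F) ▸ Algebra.mem_top)
    · rw [AlgHom.comp_apply, tVar, psi_t, Algebra.TensorProduct.map_tmul, hz, map_one]
      exact (evalXi_tVar _ _ _).symm
    · rw [AlgHom.comp_apply, psi_u, zInvDz, Algebra.TensorProduct.map_tmul, hz, evalXi_u]
      rfl
  rw [← e, map_eq_zero_iff _ (map_injective_of_left hg _)]

theorem psi_left (c : Fin m → Fin n → F) (p : MvPolynomial (Fin m) F) :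
    psi c (p ⊗ₜ 1) = h c p ⊗ₜ 1 := by
  simp [psi]

theorem mem_relIdeal_of_psi_eq_zero {c : Fin m → Fin n → F} (hc : ∀ i, c i ≠ 0) {f : Xi F m}
    (hf : psi c f = 0) : f ∈ relIdeal c Finset.univ :=
  mem_relIdeal_of_evalXi_eq_zero Finset.univ c (fun i _ => hc i) f
    (xiOn_univ (F := F) ▸ Algebra.mem_top) ((psi_eq_zero_iff hc f).1 hf)

theorem psi_relPolySuper {c : Fin m → Fin n → F} (hc : ∀ i, c i ≠ 0) {a : Fin m → F}
    {S : Finset (Fin m)} (ha : IsMinimalRelation c a) (hS : S ⊆ supp a) :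
    psi c (relPolySuper a S) = 0 :=
  (psi_eq_zero_iff hc _).2 (evalXi_recip_relPolySuper (fun i _ => hc i) ha hS)

/-- This transfers the description of `K` to `I`: under `u_i ↦ 0` only the generators with `S = ∅`
survive, and these become the `P_L`. -/
theorem augment_mem_of_mem_relIdeal {c : Fin m → Fin n → F} {J : Finset (Fin m)} {f : Xi F m}
    (hf : f ∈ relIdeal c J) : augment (MvPolynomial (Fin m) F) (Fin m → F) f ∈
      Ideal.span {p | ∃ a : Fin m → F, IsMinimalRelation c a ∧ p = relPoly a} := by
  induction hf using Submodule.span_induction with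
  | mem f hf =>
    obtain ⟨a, S, x, y, ha, _, _, _, _, rfl⟩ := hf
    rw [map_mul, map_mul]
    refine Ideal.mul_mem_right _ _ (Ideal.mul_mem_left _ _ ?_)
    rcases S.eq_empty_or_nonempty with rfl | hS
    · rw [relPolySuper_empty, augment_left]
      exact Ideal.subset_span ⟨a, ha, rfl⟩
    · rw [augment_relPolySuper hS]
      exact Ideal.zero_mem _
  | zero => rw [map_zero]; exact Ideal.zero_mem _
  | add f g _ _ hf hg => rw [map_add]; exact Ideal.add_mem _ hf hg
  | smul r f _ hf =>
    rw [map_smul, MvPolynomial.smul_eq_C_mul]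
    exact Ideal.mul_mem_left _ _ hf

theorem ker_h {c : Fin m → Fin n → F} (hc : ∀ i, c i ≠ 0) : RingHom.ker (h c) =
    Ideal.span {p | ∃ a : Fin m → F, IsMinimalRelation c a ∧ p = relPoly a} := by
  refine le_antisymm (fun p hp => ?_) (Ideal.span_le.2 ?_)
  · have hp' : psi c (p ⊗ₜ 1) = 0 := by
      rw [psi_left, RingHom.mem_ker.1 hp, TensorProduct.zero_tmul]
    have := augment_mem_of_mem_relIdeal (mem_relIdeal_of_psi_eq_zero hc hp')
    rwa [augment_left] at this
  · rintro _ ⟨a, ha, rfl⟩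
    have h0 := psi_relPolySuper hc ha (Finset.empty_subset _)
    rw [relPolySuper_empty, psi_left] at h0
    have h1 := congrArg (augment (R c) (Fin n → F)) h0
    rwa [augment_left, map_zero] at h1

theorem mem_span_of_mem_relIdeal {c : Fin m → Fin n → F} {J : Finset (Fin m)} {f : Xi F m}
    (hf : f ∈ relIdeal c J) : f ∈ TwoSidedIdeal.span {p | ∃ (a : Fin m → F) (S : Finset (Fin m)),
      IsMinimalRelation c a ∧ S ⊆ supp a ∧ p = relPolySuper a S} := by
  induction hf using Submodule.span_induction with
  | mem f hf =>
    obtain ⟨a, S, x, y, ha, _, hS, _, _, rfl⟩ := hf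
    exact TwoSidedIdeal.mul_mem_right _ _ _ (TwoSidedIdeal.mul_mem_left _ _ _
      (TwoSidedIdeal.subset_span ⟨a, S, ha, hS, rfl⟩))
  | zero => exact TwoSidedIdeal.zero_mem _
  | add f g _ _ hf hg => exact TwoSidedIdeal.add_mem _ hf hg
  | smul r f _ hf =>
    have e : r • f = algebraMap F (Xi F m) r * f := Algebra.smul_def r f
    rw [e]
    exact TwoSidedIdeal.mul_mem_left _ _ _ hf

theorem ker_psi {c : Fin m → Fin n → F} (hc : ∀ i, c i ≠ 0) : TwoSidedIdeal.ker (psi c) =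
    TwoSidedIdeal.span {p | ∃ (a : Fin m → F) (S : Finset (Fin m)),
      IsMinimalRelation c a ∧ S ⊆ supp a ∧ p = relPolySuper a S} := by
  refine le_antisymm (fun f hf => ?_) (TwoSidedIdeal.span_le.2 ?_)
  · exact mem_span_of_mem_relIdeal (mem_relIdeal_of_psi_eq_zero hc ((TwoSidedIdeal.mem_ker _).1 hf))
  · rintro _ ⟨a, S, ha, hS, rfl⟩
    exact (TwoSidedIdeal.mem_ker _).2 (psi_relPolySuper hc ha hS)

end

end

end ReciprocalPlane

theorem theorem3 {F : Type*} [Field F] {n m : ℕ} (c : Fin m → Fin n → F) (hc : ∀ i, c i ≠ 0) :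
    RingHom.ker (ReciprocalPlane.h c) =
        Ideal.span {p | ∃ a : Fin m → F, ReciprocalPlane.IsMinimalRelation c a ∧
          p = ReciprocalPlane.relPoly a} ∧
      TwoSidedIdeal.ker (ReciprocalPlane.psi c) =
        TwoSidedIdeal.span {p | ∃ (a : Fin m → F) (S : Finset (Fin m)),
          ReciprocalPlane.IsMinimalRelation c a ∧ S ⊆ ReciprocalPlane.supp a ∧
          p = ReciprocalPlane.relPolySuper a S} :=
  ⟨ReciprocalPlane.ker_h hc, ReciprocalPlane.ker_psi hc⟩
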